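/- Let $0<s<3$ and let $\Omega:S^2\to\mathbb{R}$ be smooth, strictly positive and even, i.e. $\Omega(-\bar{x})=\Omega(\bar{x})$. For $x\in\mathbb{R}^3\setminus\{0\}$ put $\bar{x}=x/|x|$ and $$W(x)=|x|^{-s}\,\Omega(\bar{x})+|x|^2,\qquad W(0)=+\infty,$$ and for a finite Borel measure $\rho$ on $\mathbb{R}^3$ let $$E[\rho]=\frac12\int_{\mathbb{R}^3}\int_{\mathbb{R}^3}W(x-y)\,d\rho(y)\,d\rho(x)\in[0,+\infty].$$ Say that $W$ has the linear interpolation convexity (LIC) property if, for any two distinct compactly supported probability measures $\rho_0\neq\rho_1$ on $\mathbb{R}^3$ with the same center of mass and with $E[\rho_0],E[\rho_1]<\infty$, the function $t\mapsto E[(1-t)\rho_0+t\rho_1]$ is finite and strictly convex on $[0,1]$. Then there is a unique continuous function $\tilde\Omega:S^2\to\mathbb{R}$ such that, in the sense of tempered distributions on $\mathbb{R}^3$ and with the convention $\mathcal{F}[f](\xi)=\int f(x)e^{-2\pi i x\cdot\xi}\,dx$, $$\mathcal{F}\big[|x|^{-s}\Omega(\bar{x})\big](\xi)=|\xi|^{-3+s}\,\tilde\Omega(\xi/|\xi|),$$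 and $W$ has the LIC property if and only if $\tilde\Omega(\bar\xi)\ge 0$ for all $\bar\xi\in S^2$. -/

import Mathlib

open MeasureTheory Metric
open scoped NNReal ENNReal Manifold ContDiff SchwartzMap FourierTransform

/-- Three-dimensional Euclidean space. -/
abbrev R3 : Type := EuclideanSpace ℝ (Fin 3)

/-- The unit sphere of three-dimensional Euclidean space. -/
abbrev S2 : Type := sphere (0 : R3) 1

/-- The angle variable `x / ‖x‖` of a nonzero vector. -/
noncomputable def angle (x : R3) (hx : x ≠ 0) : S2 :=
  ⟨‖x‖⁻¹ • x, by
    rw [mem_sphere_zero_iff_norm, norm_smul, norm_inv, norm_norm,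
      inv_mul_cancel₀ (norm_ne_zero_iff.mpr hx)]⟩

/-- The function `‖x‖ ^ p * Ω (x / ‖x‖)` on `x ≠ 0`. The value at the origin is a placeholder: it
is never used pointwise, and the origin is Lebesgue-null. -/
noncomputable def homExt (p : ℝ) (Ω : S2 → ℝ) (x : R3) : ℝ :=
  open Classical in if hx : x = 0 then 0 else ‖x‖ ^ p * Ω (angle x hx)

/-- Condition (H) on the angular profile: smooth, strictly positive and even. -/
structure ConditionH (Ω : S2 → ℝ) : Prop where
  smooth : ContMDiff (𝓡 2) 𝓘(ℝ, ℝ) ∞ Ω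
  pos : ∀ x, 0 < Ω x
  even : ∀ x, Ω (-x) = Ω x

/-- The interaction potential `W(x) = ‖x‖ ^ (-s) * Ω (x / ‖x‖) + ‖x‖ ^ 2`, with its
lower-semicontinuous value `+∞` at the origin. It takes nonnegative values when `Ω` is positive. -/
noncomputable def potential (s : ℝ) (Ω : S2 → ℝ) (x : R3) : ℝ≥0∞ :=
  open Classical in if x = 0 then ⊤ else ENNReal.ofReal (homExt (-s) Ω x + ‖x‖ ^ 2)

/-- The interaction energy `E[ρ] = (1/2) ∬ W(x - y) dρ(y) dρ(x)`, with values in `[0, +∞]`. -/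
noncomputable def interactionEnergy (W : R3 → ℝ≥0∞) (ρ : Measure R3) : ℝ≥0∞ :=
  2⁻¹ * ∫⁻ x, ∫⁻ y, W (x - y) ∂ρ ∂ρ

/-- The measure `ρ` is compactly supported. -/
def CompactlySupported (ρ : Measure R3) : Prop :=
  ∃ K : Set R3, IsCompact K ∧ ρ Kᶜ = 0

/-- Linear interpolation convexity: for any two distinct compactly supported probability measures
of finite energy with the same center of mass, the energy is strictly convex along the linear
interpolation `(1 - t) ρ₀ + t ρ₁`, `t ∈ [0, 1]`. The strict inequalities hold in `[0, +∞]`, so that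
they also say that the energy is finite along the curve. -/
def HasLIC (W : R3 → ℝ≥0∞) : Prop :=
  ∀ ρ₀ ρ₁ : Measure R3, IsProbabilityMeasure ρ₀ → IsProbabilityMeasure ρ₁ →
    CompactlySupported ρ₀ → CompactlySupported ρ₁ → ρ₀ ≠ ρ₁ →
    ∫ x, x ∂ρ₀ = ∫ x, x ∂ρ₁ →
    interactionEnergy W ρ₀ < ⊤ → interactionEnergy W ρ₁ < ⊤ →
    StrictConvexOn ℝ≥0 (Set.Icc (0 : ℝ≥0) 1)
      (fun t : ℝ≥0 => interactionEnergy W ((1 - t) • ρ₀ + t • ρ₁))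

/-- `Ωt` is the angle function of the Fourier transform of `‖x‖ ^ (-s) * Ω (x / ‖x‖)`: it is
continuous on the sphere, and in the sense of tempered distributions the Fourier transform (with
kernel `exp (-2πi x·ξ)`) is the function `‖ξ‖ ^ (-3 + s) * Ωt (ξ / ‖ξ‖)`. For `0 < s < 3` and
continuous `Ω`, both integrals converge absolutely. -/
def IsFourierAngle (s : ℝ) (Ω Ωt : S2 → ℝ) : Prop :=
  Continuous Ωt ∧ ∀ φ : 𝓢(R3, ℂ),
    ∫ x, (homExt (-s) Ω x : ℂ) * (𝓕 φ) x = ∫ ξ, (homExt (-3 + s) Ωt ξ : ℂ) * φ ξ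

/-! Existence and uniqueness of the angle function. For a radial bump η on an annulus, χ(x) = η(|x|)
Ω(x/|x|) is smooth with compact support, and c |x|^(-s) Ω(x/|x|) = ∫₀^∞ t^(-s-1) χ(x/t) dt with c >
0. Transforming under the integral gives c⁻¹ ∫₀^∞ t^(2-s) χ̂(tξ) dt, which is homogeneous of degree
s - 3 (`isFourierAngle_fourierAngle`). Two candidates agree almost everywhere and are continuous off
the origin, hence agree.

The energy on a segment is a quadratic polynomial in t, strictly convex exactly when 2B < A + D,
where A, D are the self-energies and B is the mutual energy. With equal centers of mass the part
|x|² cancels from this inequality (`strictConvexOn_interactionEnergy_iff`). Formally, for the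
singular part, A + D - 2B is the integral of |ξ|^(s-3) Ωt(ξ/|ξ|) against the squared modulus of the
transform of ρ₀ - ρ₁.

Sufficiency. The formal identity is exact once the kernel is mollified by an autocorrelation, whose
transform is nonnegative and integrable against the multiplier. As the scale tends to 0, the
self-energies converge by dominated convergence (`exists_mollified_le`), while Fatou handles the
mutual energies and the Fourier integral. The Fourier integral is not 0: Ωt is not identically zero,
so otherwise the two characteristic functions would agree on an open set, and compact support makes
them analytic (`Measure.eq_of_charFun_eventuallyEq`).

Necessity. Perturbing a uniform density shows that LIC makes the energy nonnegative on bounded,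
boundedly supported densities with zero mass and zero first moment. Second derivatives in direction
e of test functions are such densities, and bring the multiplier (ξ·e)⁴. Modulation moves the
frequencies of the test function to e/t; homogeneity and t → 0 isolate Ωt(e)
(`HasLIC.fourierAngle_nonneg`). -/

/-! ### Homogeneous extensions: scaling, bounds, integrability, smoothness. -/

lemma homExt_zero (p : ℝ) (f : S2 → ℝ) : homExt p f 0 = 0 := by simp [homExt]

lemma homExt_of_ne (p : ℝ) (f : S2 → ℝ) {x : R3} (hx : x ≠ 0) :
    homExt p f x = ‖x‖ ^ p * f (angle x hx) := by simp [homExt, hx]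

lemma homExt_coe (p : ℝ) (f : S2 → ℝ) (ξ : S2) : homExt p f ξ = f ξ := by
  have h1 : ‖(ξ : R3)‖ = 1 := norm_eq_of_mem_sphere ξ
  have h0 : (ξ : R3) ≠ 0 := norm_ne_zero_iff.1 (by rw [h1]; norm_num)
  rw [homExt_of_ne _ _ h0, h1, Real.one_rpow, one_mul]
  congr 1
  ext1
  simp [angle, h1]

lemma homExt_smul (p : ℝ) (f : S2 → ℝ) {t : ℝ} (ht : 0 < t) (x : R3) :
    homExt p f (t • x) = t ^ p * homExt p f x := by
  by_cases hx : x = 0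
  · simp [hx, homExt_zero]
  have htx : t • x ≠ 0 := smul_ne_zero ht.ne' hx
  rw [homExt_of_ne _ _ hx, homExt_of_ne _ _ htx, norm_smul, Real.norm_of_nonneg ht.le,
    Real.mul_rpow ht.le (norm_nonneg _), mul_assoc]
  congr 3
  ext1
  simp only [angle, norm_smul, Real.norm_of_nonneg ht.le, smul_smul]
  congr 1
  field_simp

lemma homExt_neg {p : ℝ} {f : S2 → ℝ} (hf : ∀ x, f (-x) = f x) (x : R3) :
    homExt p f (-x) = homExt p f x := by
  by_cases hx : x = 0
  · simp [hx]
  rw [homExt_of_ne _ _ hx, homExt_of_ne _ _ (neg_ne_zero.2 hx), norm_neg, ← hf]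
  congr 2
  ext1
  simp [angle]

lemma homExt_nonneg {p : ℝ} {f : S2 → ℝ} (hf : ∀ x, 0 ≤ f x) (x : R3) : 0 ≤ homExt p f x := by
  by_cases hx : x = 0
  · simp [hx, homExt_zero]
  rw [homExt_of_ne _ _ hx]
  exact mul_nonneg (by positivity) (hf _)

lemma exists_bound_of_continuous_sphere {f : S2 → ℝ} (hf : Continuous f) :
    ∃ M, 0 < M ∧ ∀ x, |f x| ≤ M := by
  obtain ⟨C, hC⟩ := (isCompact_range hf).isBounded.exists_norm_le
  exact ⟨max C 1, by positivity, fun x => (hC _ ⟨x, rfl⟩).trans (le_max_left _ _)⟩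

lemma abs_homExt_le {p M : ℝ} {f : S2 → ℝ} (hM0 : 0 ≤ M) (hM : ∀ x, |f x| ≤ M) (x : R3) :
    |homExt p f x| ≤ M * ‖x‖ ^ p := by
  by_cases hx : x = 0
  · rw [hx, homExt_zero, abs_zero]; positivity
  rw [homExt_of_ne _ _ hx, abs_mul, abs_of_nonneg (by positivity), mul_comm]
  gcongr
  exact hM _

lemma continuousOn_homExt (p : ℝ) {f : S2 → ℝ} (hf : Continuous f) :
    ContinuousOn (homExt p f) {0}ᶜ := by
  rw [continuousOn_iff_continuous_domRestrict]
  have : ({0}ᶜ : Set R3).domRestrict (homExt p f) =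
      fun x : ({0}ᶜ : Set R3) => ‖(x : R3)‖ ^ p * f (angle x x.2) := by
    ext x
    exact homExt_of_ne _ _ x.2
  rw [this]
  refine Continuous.mul ?_ (hf.comp ?_)
  · exact (continuous_norm.comp continuous_subtype_val).rpow_const
      fun x => Or.inl (norm_ne_zero_iff.2 x.2)
  · refine Continuous.subtype_mk ?_ _
    exact ((continuous_norm.comp continuous_subtype_val).inv₀
      fun x => norm_ne_zero_iff.2 x.2).smul continuous_subtype_val

lemma continuousAt_homExt (p : ℝ) {f : S2 → ℝ} (hf : Continuous f) {x : R3} (hx : x ≠ 0) :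
    ContinuousAt (homExt p f) x :=
  (continuousOn_homExt p hf).continuousAt (isOpen_compl_singleton.mem_nhds hx)

lemma measurable_homExt (p : ℝ) {f : S2 → ℝ} (hf : Continuous f) : Measurable (homExt p f) := by
  have : homExt p f = ({0}ᶜ : Set R3).piecewise (homExt p f) (fun _ => 0) := by
    ext x
    by_cases hx : x = 0
    · simp [hx, homExt_zero]
    · simp [Set.piecewise, hx]
  rw [this]
  exact (continuousOn_homExt p hf).measurable_piecewise continuousOn_const
    (measurableSet_singleton _).compl

lemma integrableOn_norm_rpow_ball {p : ℝ} (hp : -3 < p) (r : ℝ) :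
    IntegrableOn (fun x : R3 => ‖x‖ ^ p) (ball 0 r) := by
  rw [integrableOn_fun_norm_addHaar volume (f := fun t : ℝ => t ^ p)]
  have h3 : Module.finrank ℝ R3 = 3 := by simp
  rw [h3]
  by_cases hr : 0 ≤ r
  · have h := (intervalIntegral.intervalIntegrable_rpow' (a := 0) (b := r) (r := 2 + p)
      (by linarith)).1
    refine (h.mono_set Set.Ioo_subset_Ioc_self).congr_fun (fun t ht => ?_) measurableSet_Ioo
    simp only [smul_eq_mul]
    rw [Real.rpow_add ht.1]
    norm_num
  · rw [Set.Ioo_eq_empty (by linarith)]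
    exact integrableOn_empty

lemma integrable_norm_rpow_mul_schwartz {p : ℝ} (hp : -3 < p) (hp0 : p ≤ 0) (φ : 𝓢(R3, ℂ)) :
    Integrable (fun x : R3 => ‖x‖ ^ p * ‖φ x‖) := by
  have hm : AEStronglyMeasurable (fun x : R3 => ‖x‖ ^ p * ‖φ x‖) :=
    ((measurable_norm.pow_const p).mul φ.continuous.norm.measurable).aestronglyMeasurable
  rw [← integrableOn_univ, ← Set.union_compl_self (ball (0 : R3) 1)]
  refine IntegrableOn.union ?_ ?_
  · obtain ⟨C, hC0, hC⟩ := φ.decay 0 0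
    refine ((integrableOn_norm_rpow_ball hp 1).const_mul C).mono' hm.restrict
      (.of_forall fun x => ?_)
    have := hC x
    rw [pow_zero, one_mul, norm_iteratedFDeriv_zero] at this
    rw [Real.norm_of_nonneg (by positivity), mul_comm]
    gcongr
  · refine Integrable.mono' φ.integrable.norm.integrableOn hm.restrict ?_
    refine (ae_restrict_mem measurableSet_ball.compl).mono fun x hx => ?_
    have h1 : 1 ≤ ‖x‖ := by simpa using hx
    rw [Real.norm_of_nonneg (by positivity)]
    exact mul_le_of_le_one_left (norm_nonneg _) (Real.rpow_le_one_of_one_le_of_nonpos h1 hp0)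

lemma integrable_homExt_mul {p : ℝ} (hp : -3 < p) (hp0 : p ≤ 0) {f : S2 → ℝ} (hf : Continuous f)
    (φ : 𝓢(R3, ℂ)) : Integrable (fun x : R3 => (homExt p f x : ℂ) * φ x) := by
  obtain ⟨M, hM0, hM⟩ := exists_bound_of_continuous_sphere hf
  refine ((integrable_norm_rpow_mul_schwartz hp hp0 φ).const_mul M).mono'
    ((Complex.measurable_ofReal.comp (measurable_homExt p hf)).mul
      φ.continuous.measurable).aestronglyMeasurable (.of_forall fun x => ?_)
  rw [norm_mul, Complex.norm_real, ← mul_assoc]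
  gcongr
  exact abs_homExt_le hM0.le hM x

lemma integrableOn_homExt_ball {p : ℝ} (hp : -3 < p) {f : S2 → ℝ} (hf : Continuous f) (r : ℝ) :
    IntegrableOn (homExt p f) (ball 0 r) := by
  obtain ⟨M, hM0, hM⟩ := exists_bound_of_continuous_sphere hf
  exact ((integrableOn_norm_rpow_ball hp r).const_mul M).mono'
    (measurable_homExt p hf).aestronglyMeasurable
    (.of_forall fun x => abs_homExt_le hM0.le hM x)

lemma locallyIntegrable_homExt {p : ℝ} (hp : -3 < p) {f : S2 → ℝ} (hf : Continuous f) :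
    LocallyIntegrable (homExt p f) := by
  intro x
  refine ⟨ball 0 (‖x‖ + 1), isOpen_ball.mem_nhds ?_, integrableOn_homExt_ball hp hf _⟩
  simp

/-- Composing with Ω as a smooth map on the sphere requires a globally defined smooth map into the
sphere. The map v is the identity near x₀ and stays within ‖x₀‖ / 2 of x₀, so it never vanishes and
can be normalized everywhere. -/
lemma contDiffAt_homExt_zero {Ω : S2 → ℝ} (hΩ : ContMDiff (𝓡 2) 𝓘(ℝ, ℝ) ∞ Ω) {x₀ : R3}
    (hx₀ : x₀ ≠ 0) : ContDiffAt ℝ ∞ (homExt 0 Ω) x₀ := by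
  have hn : 0 < ‖x₀‖ := norm_pos_iff.2 hx₀
  let b : ContDiffBump x₀ := ⟨‖x₀‖ / 3, ‖x₀‖ / 2, by positivity, by linarith⟩
  let v : R3 → R3 := fun x => x₀ + b x • (x - x₀)
  have hv : ∀ x, v x ≠ 0 := by
    intro x hx
    have h1 : ‖b x • (x - x₀)‖ ≤ ‖x₀‖ / 2 := by
      by_cases h : dist x x₀ < ‖x₀‖ / 2
      · rw [norm_smul, Real.norm_of_nonneg b.nonneg, ← dist_eq_norm]
        calc b x * dist x x₀ ≤ 1 * dist x x₀ := by
              gcongr; exact b.le_one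
          _ ≤ _ := by linarith
      · rw [b.zero_of_le_dist (not_lt.1 h), zero_smul, norm_zero]
        positivity
    have h2 : x₀ = -(b x • (x - x₀)) := eq_neg_of_add_eq_zero_left hx
    have h3 : ‖x₀‖ = ‖b x • (x - x₀)‖ := by
      conv_lhs => rw [h2, norm_neg]
    linarith
  have hvs : ContDiff ℝ ∞ v :=
    contDiff_const.add (b.contDiff.smul (contDiff_id.sub contDiff_const))
  let w : R3 → R3 := fun x => ‖v x‖⁻¹ • v x
  have hws : ContDiff ℝ ∞ w :=
    ((hvs.norm ℝ hv).inv fun x => norm_ne_zero_iff.2 (hv x)).smul hvs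
  have hw : ∀ x, w x ∈ sphere (0 : R3) 1 := fun x => (angle (v x) (hv x)).2
  have hc : ContDiff ℝ ∞ (fun x => Ω (Set.codRestrict w (sphere 0 1) hw x)) := by
    rw [← contMDiff_iff_contDiff]
    have : Fact (Module.finrank ℝ R3 = 2 + 1) := ⟨by simp⟩
    exact hΩ.comp (ContMDiff.codRestrict_sphere (contMDiff_iff_contDiff.2 hws) hw)
  refine hc.contDiffAt.congr_of_eventuallyEq ?_
  filter_upwards [closedBall_mem_nhds x₀ b.rIn_pos, isOpen_compl_singleton.mem_nhds hx₀]
    with x hx hx0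
  rw [homExt_of_ne _ _ hx0, Real.rpow_zero, one_mul]
  have : v x = x := by simp [v, b.one_of_mem_closedBall hx]
  congr 1
  ext1
  simp [angle, w, this]

/-! ### The homogeneous kernel as a superposition of dilates of an annular function. -/

/-- A smooth bump on the half line, supported in `[1, 3]`. -/
noncomputable def radialBump : ContDiffBump (2 : ℝ) := ⟨1 / 2, 1, by norm_num, by norm_num⟩

lemma radialBump_eq_zero_of_le {r : ℝ} (hr : r ≤ 1) : radialBump r = 0 := by
  apply radialBump.zero_of_le_dist
  rw [Real.dist_eq, abs_of_nonpos (by linarith)]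
  simp only [radialBump]
  linarith

lemma radialBump_eq_zero_of_ge {r : ℝ} (hr : 3 ≤ r) : radialBump r = 0 := by
  apply radialBump.zero_of_le_dist
  rw [Real.dist_eq, abs_of_nonneg (by linarith)]
  simp only [radialBump]
  linarith

/-- The profile `Ω` localized to an annulus. -/
noncomputable def annular (Ω : S2 → ℝ) (x : R3) : ℝ := radialBump ‖x‖ * homExt 0 Ω x

lemma contDiff_annular {Ω : S2 → ℝ} (hΩ : ContMDiff (𝓡 2) 𝓘(ℝ, ℝ) ∞ Ω) :
    ContDiff ℝ ∞ (annular Ω) := by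
  rw [contDiff_iff_contDiffAt]
  intro x
  by_cases hx : x = 0
  · have : annular Ω =ᶠ[nhds x] fun _ => 0 := by
      filter_upwards [ball_mem_nhds x one_pos] with y hy
      have : ‖y‖ ≤ 1 := by simpa [hx] using (mem_ball.1 hy).le
      simp [annular, radialBump_eq_zero_of_le this]
    exact contDiffAt_const.congr_of_eventuallyEq this
  · exact (radialBump.contDiff.contDiffAt.comp x (contDiffAt_norm ℝ hx)).mul
      (contDiffAt_homExt_zero hΩ hx)

lemma hasCompactSupport_annular (Ω : S2 → ℝ) : HasCompactSupport (annular Ω) := by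
  refine HasCompactSupport.intro (isCompact_closedBall (0 : R3) 3) fun x hx => ?_
  have : 3 ≤ ‖x‖ := by simpa using (not_le.1 (fun h => hx (mem_closedBall_zero_iff.2 h))).le
  simp [annular, radialBump_eq_zero_of_ge this]

lemma annular_smul (Ω : S2 → ℝ) {t : ℝ} (ht : 0 < t) (x : R3) :
    annular Ω (t • x) = radialBump (t * ‖x‖) * homExt 0 Ω x := by
  rw [annular, norm_smul, Real.norm_of_nonneg ht.le, homExt_smul 0 Ω ht, Real.rpow_zero, one_mul]

section Scaling

variable {E : Type*} [NormedAddCommGroup E] [NormedSpace ℝ E]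

lemma integrableOn_rpow_smul_comp_mul {a : ℝ} {g : ℝ → E}
    (hg : IntegrableOn (fun t => t ^ a • g t) (Set.Ioi 0)) {r : ℝ} (hr : 0 < r) :
    IntegrableOn (fun t => t ^ a • g (t * r)) (Set.Ioi 0) := by
  have h := ((integrableOn_Ioi_comp_mul_right_iff (fun t => t ^ a • g t) 0 hr).2
    (by simpa using hg)).smul (r ^ (-a))
  refine IntegrableOn.congr_fun h (fun t ht => ?_) measurableSet_Ioi
  simp only [Pi.smul_apply]
  rw [Real.mul_rpow (le_of_lt ht) hr.le, smul_smul, mul_left_comm, ← Real.rpow_add hr]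
  simp

lemma integral_rpow_smul_comp_mul (a : ℝ) (g : ℝ → E) {r : ℝ} (hr : 0 < r) :
    ∫ t in Set.Ioi (0 : ℝ), t ^ a • g (t * r) =
      r ^ (-a - 1) • ∫ t in Set.Ioi (0 : ℝ), t ^ a • g t := by
  have h := integral_comp_mul_right_Ioi (fun t => t ^ a • g t) 0 hr
  rw [zero_mul] at h
  rw [Real.rpow_sub hr, Real.rpow_one, div_eq_mul_inv, ← smul_smul, ← h, ← integral_smul]
  refine setIntegral_congr_fun measurableSet_Ioi fun t ht => ?_
  rw [Real.mul_rpow (le_of_lt ht) hr.le, smul_smul, mul_left_comm, ← Real.rpow_add hr]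
  simp

end Scaling

lemma integrableOn_rpow_mul_radialBump_inv (s : ℝ) :
    IntegrableOn (fun t : ℝ => t ^ (-s - 1) • radialBump t⁻¹) (Set.Ioi 0) := by
  -- The bump vanishes outside (1, 3), so its value at t⁻¹ vanishes for t outside [1/3, 1].
  have h1 : IntegrableOn (fun t : ℝ => t ^ (-s - 1) • radialBump t⁻¹) (Set.Icc (1 / 3) 1) := by
    refine ContinuousOn.integrableOn_compact isCompact_Icc fun t ht => ?_
    have ht0 : t ≠ 0 := by have := ht.1; intro h; norm_num [h] at this
    exact ((Real.continuousAt_rpow_const _ _ (Or.inl ht0)).smul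
      (radialBump.continuous.continuousAt.comp (continuousAt_inv₀ ht0))).continuousWithinAt
  refine h1.of_forall_sdiff_eq_zero measurableSet_Ioi fun t ht => ?_
  have ht0 : 0 < t := ht.1
  rw [smul_eq_mul]
  by_cases h : t < 1 / 3
  · rw [radialBump_eq_zero_of_ge, mul_zero]
    rw [le_inv_comm₀ (by norm_num) ht0]
    linarith
  · rw [radialBump_eq_zero_of_le, mul_zero]
    have : 1 < t := by
      by_contra h'
      exact ht.2 ⟨not_lt.1 h, not_lt.1 h'⟩
    exact inv_le_one_of_one_le₀ this.le

/-- The normalizing constant in the decomposition of a homogeneous function into dilates of an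
annular one. -/
noncomputable def dilationConst (s : ℝ) : ℝ :=
  ∫ t in Set.Ioi (0 : ℝ), t ^ (-s - 1) • radialBump t⁻¹

lemma dilationConst_pos (s : ℝ) : 0 < dilationConst s := by
  unfold dilationConst
  rw [setIntegral_pos_iff_support_of_nonneg_ae
    (f := fun t : ℝ => t ^ (-s - 1) • radialBump t⁻¹) ((ae_restrict_mem measurableSet_Ioi).mono fun t ht =>
      mul_nonneg (Real.rpow_nonneg (le_of_lt ht) _) radialBump.nonneg)
    (integrableOn_rpow_mul_radialBump_inv s)]
  -- Inversion maps (5/12, 7/12) onto (12/7, 12/5), which lies inside (1, 3), where the bump is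
  -- positive.
  refine lt_of_lt_of_le ?_ (measure_mono (s := Set.Ioo (5 / 12 : ℝ) (7 / 12)) fun t ht => ?_)
  · simp
    norm_num
  have ht0 : 0 < t := by linarith [ht.1]
  refine ⟨?_, ht0⟩
  rw [Function.mem_support, smul_eq_mul]
  refine mul_ne_zero (Real.rpow_pos_of_pos ht0 _).ne' (radialBump.pos_of_mem_ball ?_).ne'
  have h1 : t⁻¹ < 12 / 5 := by
    rw [inv_lt_comm₀ ht0 (by norm_num)]; norm_num; linarith [ht.1]
  have h2 : 12 / 7 < t⁻¹ := by
    rw [lt_inv_comm₀ (by norm_num) ht0]; norm_num; linarith [ht.2]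
  rw [mem_ball, Real.dist_eq, abs_lt]
  simp only [radialBump]
  constructor <;> linarith

lemma annular_inv_smul (Ω : S2 → ℝ) {t : ℝ} (ht : 0 < t) (x : R3) :
    annular Ω (t⁻¹ • x) = radialBump (t * ‖x‖⁻¹)⁻¹ * homExt 0 Ω x := by
  rw [annular_smul Ω (inv_pos.2 ht), mul_inv, inv_inv]

lemma integrableOn_rpow_mul_annular (s : ℝ) (Ω : S2 → ℝ) (x : R3) :
    IntegrableOn (fun t : ℝ => t ^ (-s - 1) * annular Ω (t⁻¹ • x)) (Set.Ioi 0) := by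
  by_cases hx : x = 0
  · simp [hx, annular, homExt_zero]
  have h := (integrableOn_rpow_smul_comp_mul (integrableOn_rpow_mul_radialBump_inv s)
    (inv_pos.2 (norm_pos_iff.2 hx))).mul_const (homExt 0 Ω x)
  refine IntegrableOn.congr_fun h (fun t ht => ?_) measurableSet_Ioi
  simp only [annular_inv_smul Ω ht, smul_eq_mul, mul_assoc]

/-- The substitution t = ‖x‖ u pulls out ‖x‖ ^ (-s) and leaves a constant independent of x. At the
origin both sides are 0 by the placeholder value. -/
lemma integral_rpow_mul_annular (s : ℝ) (Ω : S2 → ℝ) (x : R3) :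
    ∫ t in Set.Ioi (0 : ℝ), t ^ (-s - 1) * annular Ω (t⁻¹ • x) =
      dilationConst s * homExt (-s) Ω x := by
  by_cases hx : x = 0
  · simp [hx, annular, homExt_zero]
  have hr := norm_pos_iff.2 hx
  have h := integral_rpow_smul_comp_mul (-s - 1) (fun t => radialBump t⁻¹) (inv_pos.2 hr)
  have h2 : ∫ t in Set.Ioi (0 : ℝ), t ^ (-s - 1) * annular Ω (t⁻¹ • x) =
      ∫ t in Set.Ioi (0 : ℝ), (t ^ (-s - 1) • radialBump (t * ‖x‖⁻¹)⁻¹) * homExt 0 Ω x := by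
    refine setIntegral_congr_fun measurableSet_Ioi fun t ht => ?_
    simp only [annular_inv_smul Ω ht, smul_eq_mul, mul_assoc]
  rw [h2, integral_mul_const, h, homExt_of_ne _ _ hx, homExt_of_ne _ _ hx, dilationConst]
  have h3 : ‖x‖⁻¹ ^ (-(-s - 1) - 1) = ‖x‖ ^ (-s) := by
    rw [Real.inv_rpow hr.le, ← Real.rpow_neg hr.le]; ring_nf
  rw [h3, Real.rpow_zero, smul_eq_mul]
  ring

/-! ### Fourier transform of the annular function and existence of the angle function. -/

/-- The Fourier transform of the annular localization of `Ω`. -/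
noncomputable def annularHat (Ω : S2 → ℝ) : R3 → ℂ := 𝓕 (fun x => (annular Ω x : ℂ))

lemma exists_annularHat_eq_schwartz {Ω : S2 → ℝ} (hΩ : ContMDiff (𝓡 2) 𝓘(ℝ, ℝ) ∞ Ω) :
    ∃ ψ : 𝓢(R3, ℂ), ⇑ψ = annularHat Ω := by
  have hc : ContDiff ℝ ∞ (fun x => (annular Ω x : ℂ)) :=
    Complex.ofRealCLM.contDiff.comp (contDiff_annular hΩ)
  have hs : HasCompactSupport (fun x => (annular Ω x : ℂ)) :=
    (hasCompactSupport_annular Ω).comp_left Complex.ofReal_zero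
  exact ⟨𝓕 (hs.toSchwartzMap hc), by rw [SchwartzMap.fourier_coe]; rfl⟩

lemma continuous_annularHat {Ω : S2 → ℝ} (hΩ : ContMDiff (𝓡 2) 𝓘(ℝ, ℝ) ∞ Ω) :
    Continuous (annularHat Ω) := by
  obtain ⟨ψ, hψ⟩ := exists_annularHat_eq_schwartz hΩ
  exact hψ ▸ ψ.continuous

lemma SchwartzMap.exists_norm_le_one_add_rpow_neg (ψ : 𝓢(R3, ℂ)) (k : ℕ) :
    ∃ C, 0 < C ∧ ∀ x, ‖ψ x‖ ≤ C * (1 + ‖x‖) ^ (-(k : ℝ)) := by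
  have h := SchwartzMap.one_add_le_sup_seminorm_apply (𝕜 := ℝ) (m := (k, 0)) le_rfl le_rfl ψ
  refine ⟨max (2 ^ k * ((Finset.Iic (k, 0)).sup fun m => SchwartzMap.seminorm ℝ m.1 m.2) ψ) 1,
    lt_max_of_lt_right one_pos, fun x => ?_⟩
  have h1 : (0 : ℝ) < 1 + ‖x‖ := by positivity
  rw [Real.rpow_neg h1.le, ← div_eq_mul_inv, le_div_iff₀ (by positivity), mul_comm]
  refine le_trans ?_ ((h x).trans (le_max_left _ _))
  rw [norm_iteratedFDeriv_zero, Real.rpow_natCast]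

/-- Of the Schwartz decay, order 3 suffices: multiplied by t ^ (2 - s) it leaves t ^ (-1 - s) at
infinity. -/
lemma exists_annularHat_decay {Ω : S2 → ℝ} (hΩ : ContMDiff (𝓡 2) 𝓘(ℝ, ℝ) ∞ Ω) :
    ∃ C, 0 < C ∧ ∀ ξ, ‖annularHat Ω ξ‖ ≤ C * (1 + ‖ξ‖) ^ (-3 : ℝ) := by
  obtain ⟨ψ, hψ⟩ := exists_annularHat_eq_schwartz hΩ
  simpa [hψ] using ψ.exists_norm_le_one_add_rpow_neg 3

lemma annular_neg {Ω : S2 → ℝ} (he : ∀ x, Ω (-x) = Ω x) (x : R3) :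
    annular Ω (-x) = annular Ω x := by
  rw [annular, annular, norm_neg, homExt_neg he]

/-- The Fourier transform of a real even function is real. -/
lemma fourier_ofReal_re_of_even {f : R3 → ℝ} (hf : ∀ x, f (-x) = f x) (ξ : R3) :
    ((𝓕 (fun x => (f x : ℂ)) ξ).re : ℂ) = 𝓕 (fun x => (f x : ℂ)) ξ := by
  rw [← Complex.conj_eq_iff_re, Real.fourier_eq, ← integral_conj, ← integral_neg_eq_self]
  congr 1
  ext x
  simp only [hf, inner_neg_left, neg_neg, Circle.smul_def, smul_eq_mul, map_mul,
    Complex.conj_ofReal]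
  congr 1
  rw [← Circle.coe_inv_eq_conj, ← AddChar.map_neg_eq_inv]

lemma annularHat_re {Ω : S2 → ℝ} (he : ∀ x, Ω (-x) = Ω x) (ξ : R3) :
    ((annularHat Ω ξ).re : ℂ) = annularHat Ω ξ :=
  fourier_ofReal_re_of_even (annular_neg he) ξ

lemma fourier_comp_inv_smul (f : R3 → ℂ) {t : ℝ} (ht : 0 < t) (ξ : R3) :
    𝓕 (fun x => f (t⁻¹ • x)) ξ = (t ^ 3 : ℝ) * 𝓕 f (t • ξ) := by
  rw [Real.fourier_eq, Real.fourier_eq]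
  have h := Measure.integral_comp_inv_smul_of_nonneg (volume : Measure R3)
    (fun x => Real.fourierChar (-inner ℝ x (t • ξ)) • f x) ht.le
  have h3 : Module.finrank ℝ R3 = 3 := by simp
  rw [h3] at h
  rw [← Complex.real_smul, ← h]
  congr 1
  ext x
  rw [inner_smul_left, inner_smul_right]
  simp [ht.ne']

/-- This is self-adjointness of the Fourier transform, ∫ f̂ g = ∫ f ĝ, applied to one dilate. -/
lemma integral_annular_mul_fourier {Ω : S2 → ℝ} (hΩ : ContMDiff (𝓡 2) 𝓘(ℝ, ℝ) ∞ Ω) {t : ℝ}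
    (ht : 0 < t) (φ : 𝓢(R3, ℂ)) :
    ∫ x, (annular Ω (t⁻¹ • x) : ℂ) * (𝓕 φ) x =
      ∫ ξ, ((t ^ 3 : ℝ) : ℂ) * annularHat Ω (t • ξ) * φ ξ := by
  have hc : Continuous (fun x => (annular Ω (t⁻¹ • x) : ℂ)) :=
    Complex.continuous_ofReal.comp ((contDiff_annular hΩ).continuous.comp (continuous_const_smul _))
  have hs : HasCompactSupport (fun x => (annular Ω (t⁻¹ • x) : ℂ)) :=
    ((hasCompactSupport_annular Ω).comp_smul (inv_ne_zero ht.ne')).comp_left Complex.ofReal_zero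
  have h := VectorFourier.integral_fourierIntegral_smul_eq_flip (L := innerₗ R3)
    Real.continuous_fourierChar continuous_inner (μ := volume) (hc.integrable_of_hasCompactSupport hs)
    (φ.integrable (μ := volume))
  rw [flip_innerₗ] at h
  refine h.symm.trans (integral_congr_ae (.of_forall fun ξ => ?_))
  exact congrArg (· * φ ξ) (fourier_comp_inv_smul (fun x => (annular Ω x : ℂ)) ht ξ)

/-- Convergence at 0 needs 2 - s > -1, that is s < 3; convergence at infinity needs -1 - s < -1,
that is 0 < s. -/
lemma integrableOn_rpow_mul_one_add {s : ℝ} (hs0 : 0 < s) (hs3 : s < 3) :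
    IntegrableOn (fun t : ℝ => t ^ (2 - s) • (1 + t) ^ (-3 : ℝ)) (Set.Ioi 0) := by
  have hm : Measurable (fun t : ℝ => t ^ (2 - s) • (1 + t) ^ (-3 : ℝ)) :=
    (measurable_id.pow_const _).smul ((measurable_const.add measurable_id).pow_const _)
  rw [← Set.Ioc_union_Ioi_eq_Ioi zero_le_one]
  refine IntegrableOn.union ?_ ?_
  · have h := (intervalIntegral.intervalIntegrable_rpow' (a := 0) (b := 1) (r := 2 - s)
      (by linarith)).1
    refine Integrable.mono' h hm.aestronglyMeasurable
      ((ae_restrict_mem measurableSet_Ioc).mono fun t ht => ?_)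
    have ht0 : 0 < t := ht.1
    rw [smul_eq_mul, Real.norm_of_nonneg (by positivity)]
    exact mul_le_of_le_one_right (by positivity)
      (Real.rpow_le_one_of_one_le_of_nonpos (by linarith) (by norm_num))
  · have h := integrableOn_Ioi_rpow_of_lt (a := -1 - s) (by linarith) one_pos
    refine Integrable.mono' h hm.aestronglyMeasurable
      ((ae_restrict_mem measurableSet_Ioi).mono fun t ht => ?_)
    have ht0 : 0 < t := lt_trans one_pos ht
    rw [smul_eq_mul, Real.norm_of_nonneg (by positivity)]
    calc t ^ (2 - s) * (1 + t) ^ (-3 : ℝ) ≤ t ^ (2 - s) * t ^ (-3 : ℝ) := by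
          refine mul_le_mul_of_nonneg_left ?_ (by positivity)
          exact Real.rpow_le_rpow_of_nonpos ht0 (by linarith) (by norm_num)
      _ = t ^ (-1 - s) := by rw [← Real.rpow_add ht0]; ring_nf

/-- The angle function of the Fourier transform of `‖x‖ ^ (-s) * Ω (x / ‖x‖)`. -/
noncomputable def fourierAngle (s : ℝ) (Ω : S2 → ℝ) (ξ : S2) : ℝ :=
  (dilationConst s)⁻¹ * ∫ t in Set.Ioi (0 : ℝ), t ^ (2 - s) • (annularHat Ω (t • (ξ : R3))).re

section FourierAngle

variable {s : ℝ} {Ω : S2 → ℝ}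

lemma continuous_fourierAngle (hs0 : 0 < s) (hs3 : s < 3)
    (hΩ : ContMDiff (𝓡 2) 𝓘(ℝ, ℝ) ∞ Ω) : Continuous (fourierAngle s Ω) := by
  obtain ⟨C, hC0, hC⟩ := exists_annularHat_decay hΩ
  refine continuous_const.mul (continuous_of_dominated
    (bound := fun t => C * (t ^ (2 - s) • (1 + t) ^ (-3 : ℝ))) ?_ ?_ ?_ ?_)
  · intro ξ
    have : Continuous fun t : ℝ => (annularHat Ω (t • (ξ : R3))).re :=
      Complex.continuous_re.comp ((continuous_annularHat hΩ).comp
        (continuous_id.smul continuous_const))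
    exact ((measurable_id.pow_const _).smul this.measurable).aestronglyMeasurable
  · intro ξ
    refine (ae_restrict_mem measurableSet_Ioi).mono fun t ht => ?_
    have ht0 : 0 < t := ht
    have h1 : ‖(ξ : R3)‖ = 1 := norm_eq_of_mem_sphere ξ
    rw [norm_smul, Real.norm_of_nonneg (by positivity), smul_eq_mul, mul_left_comm]
    gcongr
    have := hC (t • (ξ : R3))
    rw [norm_smul, h1, mul_one, Real.norm_of_nonneg ht0.le] at this
    exact (Complex.abs_re_le_norm _).trans this
  · exact (integrableOn_rpow_mul_one_add hs0 hs3).const_mul C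
  · refine .of_forall fun t => ?_
    have : Continuous fun ξ : S2 => (annularHat Ω (t • (ξ : R3))).re :=
      Complex.continuous_re.comp ((continuous_annularHat hΩ).comp
        (continuous_subtype_val.const_smul t))
    exact this.const_smul (t ^ (2 - s))

/-- Rescaling t by ‖ξ‖ produces the homogeneity; the real part loses nothing because the transform
of a real even function is real. -/
lemma homExt_fourierAngle (he : ∀ x, Ω (-x) = Ω x) {ξ : R3} (hξ : ξ ≠ 0) :
    (homExt (-3 + s) (fourierAngle s Ω) ξ : ℂ) =
      (dilationConst s : ℂ)⁻¹ *
        ∫ t in Set.Ioi (0 : ℝ), ((t ^ (2 - s) : ℝ) : ℂ) * annularHat Ω (t • ξ) := by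
  have hr := norm_pos_iff.2 hξ
  have h := integral_rpow_smul_comp_mul (2 - s)
    (fun t => (annularHat Ω (t • (angle ξ hξ : R3))).re) hr
  have h1 : ∀ t : ℝ, (t * ‖ξ‖) • (angle ξ hξ : R3) = t • ξ := by
    intro t
    simp only [angle, smul_smul]
    rw [mul_assoc, mul_inv_cancel₀ hr.ne', mul_one]
  simp only [h1] at h
  have h2 : -(2 - s) - 1 = -3 + s := by ring
  rw [h2, smul_eq_mul] at h
  rw [homExt_of_ne _ _ hξ, fourierAngle, mul_left_comm, ← h]
  push_cast
  rw [← integral_complex_ofReal]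
  congr 2
  ext t
  rw [← annularHat_re he]
  simp

/-- This licenses Fubini on the Fourier side. Integrating the decay bound in t gives a multiple of
‖ξ‖ ^ (-3 + s), which is integrable against a Schwartz function. -/
lemma integrable_annularHat_prod (hs0 : 0 < s) (hs3 : s < 3)
    (hΩ : ContMDiff (𝓡 2) 𝓘(ℝ, ℝ) ∞ Ω) (φ : 𝓢(R3, ℂ)) :
    Integrable (fun p : R3 × ℝ =>
      ((p.2 ^ (2 - s) : ℝ) : ℂ) * annularHat Ω (p.2 • p.1) * φ p.1)
      ((volume : Measure R3).prod (volume.restrict (Set.Ioi 0))) := by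
  obtain ⟨C, hC0, hC⟩ := exists_annularHat_decay hΩ
  have hI := integrableOn_rpow_mul_one_add hs0 hs3
  have hm : AEStronglyMeasurable (fun p : R3 × ℝ =>
      C * (p.2 ^ (2 - s) * (1 + p.2 * ‖p.1‖) ^ (-3 : ℝ)) * ‖φ p.1‖)
      ((volume : Measure R3).prod (volume.restrict (Set.Ioi 0))) := by
    refine Measurable.aestronglyMeasurable ?_
    refine Measurable.mul (Measurable.const_mul (Measurable.mul ?_ ?_) _) ?_
    · exact measurable_snd.pow_const _
    · exact (measurable_const.add (measurable_snd.mul measurable_fst.norm)).pow_const _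
    · exact (φ.continuous.norm.measurable).comp measurable_fst
  have hb : Integrable (fun p : R3 × ℝ =>
      C * (p.2 ^ (2 - s) * (1 + p.2 * ‖p.1‖) ^ (-3 : ℝ)) * ‖φ p.1‖)
      ((volume : Measure R3).prod (volume.restrict (Set.Ioi 0))) := by
    rw [integrable_prod_iff hm]
    have h0 : ∀ᵐ ξ : R3, ξ ≠ 0 := by
      simp [ae_iff]
    refine ⟨h0.mono fun ξ hξ => ?_, ?_⟩
    · exact ((integrableOn_rpow_smul_comp_mul hI (norm_pos_iff.2 hξ)).const_mul C).mul_const ‖φ ξ‖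
    · have := (integrable_norm_rpow_mul_schwartz (p := -3 + s) (by linarith) (by linarith)
        φ).const_mul (C * ∫ t in Set.Ioi (0 : ℝ), t ^ (2 - s) • (1 + t) ^ (-3 : ℝ))
      refine this.congr (h0.mono fun ξ hξ => ?_)
      have h := integral_rpow_smul_comp_mul (2 - s) (fun t => (1 + t) ^ (-3 : ℝ))
        (norm_pos_iff.2 hξ)
      have h2 : -(2 - s) - 1 = -3 + s := by ring
      simp only [h2, smul_eq_mul] at h
      have h3 : ∫ t in Set.Ioi (0 : ℝ), ‖C * (t ^ (2 - s) * (1 + t * ‖ξ‖) ^ (-3 : ℝ)) * ‖φ ξ‖‖ =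
          ∫ t in Set.Ioi (0 : ℝ), C * (t ^ (2 - s) * (1 + t * ‖ξ‖) ^ (-3 : ℝ)) * ‖φ ξ‖ := by
        refine setIntegral_congr_fun measurableSet_Ioi fun t ht => ?_
        have ht0 : 0 < t := ht
        exact Real.norm_of_nonneg (by positivity)
      simp only [h3]
      rw [integral_mul_const, integral_const_mul, h]
      simp only [smul_eq_mul]
      ring
  refine hb.mono' ?_ ?_
  · refine Measurable.aestronglyMeasurable ?_
    refine Measurable.mul (Measurable.mul ?_ ?_) ?_
    · exact Complex.measurable_ofReal.comp (measurable_snd.pow_const _)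
    · exact ((continuous_annularHat hΩ).comp (continuous_snd.smul continuous_fst)).measurable
    · exact φ.continuous.measurable.comp measurable_fst
  · have h0 : ∀ᵐ p : R3 × ℝ ∂((volume : Measure R3).prod (volume.restrict (Set.Ioi 0))),
        p.2 ∈ Set.Ioi (0 : ℝ) :=
      Measure.quasiMeasurePreserving_snd.ae (ae_restrict_mem measurableSet_Ioi)
    refine h0.mono fun p hp => ?_
    have hp0 : 0 < p.2 := hp
    have h := hC (p.2 • p.1)
    rw [norm_smul, Real.norm_of_nonneg hp0.le] at h
    rw [norm_mul, norm_mul, Complex.norm_real, Real.norm_of_nonneg (by positivity),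
      mul_left_comm]
    gcongr

/-- This licenses Fubini on the space side. Positivity of Ω lets the t-integral of the norm be
evaluated exactly, as a multiple of the kernel itself. -/
lemma integrable_annular_prod (hs0 : 0 < s) (hs3 : s < 3)
    (hΩ : ConditionH Ω) (ψ : 𝓢(R3, ℂ)) :
    Integrable (fun p : R3 × ℝ =>
      ((p.2 ^ (-s - 1) * annular Ω (p.2⁻¹ • p.1) : ℝ) : ℂ) * ψ p.1)
      ((volume : Measure R3).prod (volume.restrict (Set.Ioi 0))) := by
  have hm : AEStronglyMeasurable (fun p : R3 × ℝ =>
      ((p.2 ^ (-s - 1) * annular Ω (p.2⁻¹ • p.1) : ℝ) : ℂ) * ψ p.1)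
      ((volume : Measure R3).prod (volume.restrict (Set.Ioi 0))) := by
    refine Measurable.aestronglyMeasurable (Measurable.mul
      (Complex.measurable_ofReal.comp (Measurable.mul ?_ ?_)) ?_)
    · exact measurable_snd.pow_const _
    · exact (contDiff_annular hΩ.smooth).continuous.measurable.comp
        (measurable_snd.inv.smul measurable_fst)
    · exact ψ.continuous.measurable.comp measurable_fst
  rw [integrable_prod_iff hm]
  refine ⟨.of_forall fun x => ?_, ?_⟩
  · exact Integrable.mul_const (integrableOn_rpow_mul_annular s Ω x).ofReal (ψ x)
  · have := (integrable_homExt_mul (p := -s) (by linarith) (by linarith) hΩ.smooth.continuous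
      ψ).norm.const_mul (dilationConst s)
    refine this.congr (.of_forall fun x => ?_)
    have h3 : ∫ t in Set.Ioi (0 : ℝ), ‖((t ^ (-s - 1) * annular Ω (t⁻¹ • x) : ℝ) : ℂ) * ψ x‖ =
        ∫ t in Set.Ioi (0 : ℝ), (t ^ (-s - 1) * annular Ω (t⁻¹ • x)) * ‖ψ x‖ := by
      refine setIntegral_congr_fun measurableSet_Ioi fun t ht => ?_
      have ht0 : 0 < t := ht
      have : 0 ≤ annular Ω (t⁻¹ • x) :=
        mul_nonneg radialBump.nonneg (homExt_nonneg (fun x => (hΩ.pos x).le) _)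
      simp only [norm_mul, Complex.norm_real]
      rw [← norm_mul, Real.norm_of_nonneg (by positivity)]
    simp only [h3]
    rw [integral_mul_const, integral_rpow_mul_annular, norm_mul, Complex.norm_real,
      Real.norm_of_nonneg (homExt_nonneg (fun x => (hΩ.pos x).le) x)]
    ring

/-- The transform is moved across the pairing one dilate at a time, between two applications of
Fubini. -/
theorem isFourierAngle_fourierAngle (hs0 : 0 < s) (hs3 : s < 3) (hΩ : ConditionH Ω) :
    IsFourierAngle s Ω (fourierAngle s Ω) := by
  refine ⟨continuous_fourierAngle hs0 hs3 hΩ.smooth, fun φ => ?_⟩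
  have hc : (dilationConst s : ℂ) ≠ 0 := Complex.ofReal_ne_zero.2 (dilationConst_pos s).ne'
  refine mul_left_cancel₀ hc ?_
  calc (dilationConst s : ℂ) * ∫ x, (homExt (-s) Ω x : ℂ) * (𝓕 φ) x
      = ∫ x, ∫ t in Set.Ioi (0 : ℝ),
          ((t ^ (-s - 1) * annular Ω (t⁻¹ • x) : ℝ) : ℂ) * (𝓕 φ) x := by
        rw [← integral_const_mul]
        congr 1
        ext x
        rw [integral_mul_const, integral_complex_ofReal, integral_rpow_mul_annular]
        push_cast
        ring
    _ = ∫ t in Set.Ioi (0 : ℝ), ∫ x,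
          ((t ^ (-s - 1) * annular Ω (t⁻¹ • x) : ℝ) : ℂ) * (𝓕 φ) x :=
        integral_integral_swap (integrable_annular_prod hs0 hs3 hΩ (𝓕 φ))
    _ = ∫ t in Set.Ioi (0 : ℝ), ∫ ξ,
          ((t ^ (2 - s) : ℝ) : ℂ) * annularHat Ω (t • ξ) * φ ξ := by
        refine setIntegral_congr_fun measurableSet_Ioi fun t ht => ?_
        have ht0 : 0 < t := ht
        have h := integral_annular_mul_fourier hΩ.smooth ht0 φ
        -- The factor t ^ 3 is the Jacobian of the dilation.
        have h1 : t ^ (2 - s) = t ^ (-s - 1) * t ^ 3 := by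
          rw [← Real.rpow_natCast, ← Real.rpow_add ht0]
          congr 1
          push_cast
          ring
        simp only [h1, Complex.ofReal_mul, mul_assoc] at h ⊢
        rw [integral_const_mul, h, ← integral_const_mul]
    _ = ∫ ξ, ∫ t in Set.Ioi (0 : ℝ),
          ((t ^ (2 - s) : ℝ) : ℂ) * annularHat Ω (t • ξ) * φ ξ :=
        (integral_integral_swap (integrable_annularHat_prod hs0 hs3 hΩ.smooth φ)).symm
    _ = _ := by
        rw [← integral_const_mul]
        have h0 : ∀ᵐ ξ : R3, ξ ≠ 0 := by
          simp [ae_iff]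
        refine integral_congr_ae (h0.mono fun ξ hξ => ?_)
        simp only
        rw [integral_mul_const, homExt_fourierAngle hΩ.even hξ, ← mul_assoc, ← mul_assoc,
          mul_inv_cancel₀ hc, one_mul]

end FourierAngle

/-! ### Uniqueness of the angle function. -/

lemma eq_of_homExt_ae_eq {p : ℝ} {f g : S2 → ℝ} (hf : Continuous f) (hg : Continuous g)
    (h : homExt p f =ᵐ[volume] homExt p g) : f = g := by
  have h1 : Set.EqOn (homExt p f) (homExt p g) ({0}ᶜ : Set R3) :=
    Measure.eqOn_open_of_ae_eq (ae_restrict_of_ae h) isOpen_compl_singleton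
      (continuousOn_homExt p hf) (continuousOn_homExt p hg)
  ext ξ
  have h0 : (ξ : R3) ≠ 0 := by
    have := norm_eq_of_mem_sphere ξ
    exact norm_ne_zero_iff.1 (by rw [this]; norm_num)
  rw [← homExt_coe p f, ← homExt_coe p g, h1 h0]

/-- Testing on smooth compactly supported functions identifies the two locally integrable extensions
almost everywhere; continuity off the origin then reaches every point of the sphere. -/
theorem IsFourierAngle.unique {s : ℝ} {Ω f g : S2 → ℝ} (hs0 : 0 < s) (hs3 : s < 3)
    (hf : IsFourierAngle s Ω f) (hg : IsFourierAngle s Ω g) : f = g := by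
  refine eq_of_homExt_ae_eq (p := -3 + s) hf.1 hg.1 ?_
  have hl : LocallyIntegrable (homExt (-3 + s) f - homExt (-3 + s) g) :=
    (locallyIntegrable_homExt (by linarith) hf.1).sub
      (locallyIntegrable_homExt (by linarith) hg.1)
  have := ae_eq_zero_of_integral_contDiff_smul_eq_zero hl fun χ hχ hχs => ?_
  · exact this.mono fun x hx => sub_eq_zero.1 hx
  have hc : ContDiff ℝ ∞ (fun x => (χ x : ℂ)) := Complex.ofRealCLM.contDiff.comp hχ
  have hs : HasCompactSupport (fun x => (χ x : ℂ)) := hχs.comp_left Complex.ofReal_zero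
  let φ : 𝓢(R3, ℂ) := hs.toSchwartzMap hc
  have h1 := (hf.2 φ).symm.trans (hg.2 φ)
  rw [← sub_eq_zero, ← integral_sub
    (integrable_homExt_mul (by linarith) (by linarith) hf.1 φ)
    (integrable_homExt_mul (by linarith) (by linarith) hg.1 φ)] at h1
  rw [← Complex.ofReal_inj, ← integral_complex_ofReal, Complex.ofReal_zero, ← h1]
  congr 1
  ext x
  have : φ x = χ x := rfl
  simp only [this, smul_eq_mul, Pi.sub_apply]
  push_cast
  ring

/-! ### Energy along a segment as a quadratic polynomial. -/

/-- The mutual energy `∬ W(x - y) dσ(y) dρ(x)`. -/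
noncomputable def mutualEnergy (W : R3 → ℝ≥0∞) (ρ σ : Measure R3) : ℝ≥0∞ :=
  ∫⁻ x, ∫⁻ y, W (x - y) ∂σ ∂ρ

section MutualEnergy

variable {W : R3 → ℝ≥0∞} {ρ σ : Measure R3}

lemma mutualEnergy_comm (hW : Measurable W) (he : ∀ x, W (-x) = W x) [SFinite ρ] [SFinite σ] :
    mutualEnergy W ρ σ = mutualEnergy W σ ρ := by
  have hm : Measurable fun p : R3 × R3 => W (p.1 - p.2) :=
    hW.comp (measurable_fst.sub measurable_snd)
  unfold mutualEnergy
  rw [lintegral_lintegral_swap hm.aemeasurable]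
  congr 1
  ext y
  congr 1
  ext x
  rw [← he, neg_sub]

lemma mutualEnergy_add {W' : R3 → ℝ≥0∞} (hW : Measurable W) [SFinite σ] :
    mutualEnergy (W + W') ρ σ = mutualEnergy W ρ σ + mutualEnergy W' ρ σ := by
  unfold mutualEnergy
  have hm : Measurable fun p : R3 × R3 => W (p.1 - p.2) :=
    hW.comp (measurable_fst.sub measurable_snd)
  rw [← lintegral_add_left hm.lintegral_prod_right']
  congr 1
  ext x
  exact lintegral_add_left (hm.comp measurable_prodMk_left) _

lemma interactionEnergy_combination (hW : Measurable W) (he : ∀ x, W (-x) = W x) [SFinite ρ]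
    [SFinite σ] (a b : ℝ≥0) :
    interactionEnergy W (a • ρ + b • σ) = 2⁻¹ * (a ^ 2 * mutualEnergy W ρ ρ +
      2 * a * b * mutualEnergy W ρ σ + b ^ 2 * mutualEnergy W σ σ) := by
  have hm : Measurable fun p : R3 × R3 => W (p.1 - p.2) :=
    hW.comp (measurable_fst.sub measurable_snd)
  have h1 : ∀ x, ∫⁻ y, W (x - y) ∂(a • ρ + b • σ) =
      a * ∫⁻ y, W (x - y) ∂ρ + b * ∫⁻ y, W (x - y) ∂σ := by
    intro x
    rw [lintegral_add_measure, lintegral_smul_measure, lintegral_smul_measure]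
    rfl
  have hρ : Measurable fun x => ∫⁻ y, W (x - y) ∂ρ := hm.lintegral_prod_right'
  have hσ : Measurable fun x => ∫⁻ y, W (x - y) ∂σ := hm.lintegral_prod_right'
  have h2 : ∀ τ : Measure R3,
      ∫⁻ x, (a * ∫⁻ y, W (x - y) ∂ρ + b * ∫⁻ y, W (x - y) ∂σ) ∂τ =
        a * mutualEnergy W τ ρ + b * mutualEnergy W τ σ := by
    intro τ
    rw [lintegral_add_left (hρ.const_mul _), lintegral_const_mul _ hρ, lintegral_const_mul _ hσ]
    rfl
  unfold interactionEnergy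
  simp only [h1]
  rw [lintegral_add_measure, lintegral_smul_measure, lintegral_smul_measure, h2, h2,
    mutualEnergy_comm hW he (ρ := σ) (σ := ρ)]
  simp only [ENNReal.smul_def, smul_eq_mul]
  ring

lemma interactionEnergy_eq_mutualEnergy : interactionEnergy W ρ = 2⁻¹ * mutualEnergy W ρ ρ := rfl

lemma mutualEnergy_self_lt_top_iff : interactionEnergy W ρ < ⊤ ↔ mutualEnergy W ρ ρ < ⊤ := by
  rw [interactionEnergy_eq_mutualEnergy, ENNReal.mul_lt_top_iff]
  constructor
  · rintro (⟨_, h⟩ | h | h)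
    · exact h
    · simp at h
    · simp [h]
  · exact fun h => Or.inl ⟨by simp, h⟩

/-- The convexity gap of a quadratic with second-order coefficient q / 2 is q a b (x - y)² / 2, here
with q = A + D - 2B. Finiteness of B is forced by the strict inequality. -/
lemma strictConvexOn_quadratic {A B D : ℝ≥0∞} (hA : A < ⊤) (hD : D < ⊤) (h : 2 * B < A + D) :
    StrictConvexOn ℝ≥0 (Set.Icc (0 : ℝ≥0) 1) (fun t : ℝ≥0 =>
      2⁻¹ * (((1 - t : ℝ≥0) : ℝ≥0∞) ^ 2 * A + 2 * ((1 - t : ℝ≥0) : ℝ≥0∞) * t * B + t ^ 2 * D)) := by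
  have hB : B < ⊤ := by
    have h1 : 2 * B < ⊤ := h.trans (ENNReal.add_lt_top.2 ⟨hA, hD⟩)
    exact lt_of_le_of_lt (by rw [two_mul]; exact le_self_add) h1
  lift A to ℝ≥0 using hA.ne
  lift B to ℝ≥0 using hB.ne
  lift D to ℝ≥0 using hD.ne
  have hq : (2 * B : ℝ) < A + D := by exact_mod_cast h
  refine ⟨convex_Icc _ _, fun x hx y hy hxy a b ha hb hab => ?_⟩
  have hz : a • x + b • y ≤ 1 := (convex_Icc (0 : ℝ≥0) 1 hx hy ha.le hb.le hab).2
  have h2 : (2⁻¹ : ℝ≥0∞) = ((2⁻¹ : ℝ≥0) : ℝ≥0∞) := by simp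
  simp only [ENNReal.smul_def, smul_eq_mul, h2]
  norm_cast
  rw [← NNReal.coe_lt_coe]
  have hz' : a * x + b * y ≤ 1 := hz
  push_cast [NNReal.coe_sub hx.2, NNReal.coe_sub hy.2, NNReal.coe_sub hz']
  have hab' : (b : ℝ) = 1 - a := by
    have : (a : ℝ) + b = 1 := by exact_mod_cast hab
    linarith
  have hxy' : (x : ℝ) - y ≠ 0 := sub_ne_zero.2 fun h => hxy (NNReal.coe_injective h)
  have ha' : (0 : ℝ) < a := ha
  have hb' : (0 : ℝ) < b := hb
  have key : 0 < ((A : ℝ) + D - 2 * B) * (a * b * ((x : ℝ) - y) ^ 2) :=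
    mul_pos (by linarith) (by positivity)
  rw [hab'] at key ⊢
  nlinarith [key]

/-- The midpoint suffices: it reads (A + 2B + D) / 8 < (A + D) / 4. An infinite B would make the
left side infinite. -/
lemma lt_of_strictConvexOn_quadratic {A B D : ℝ≥0∞} (hA : A < ⊤) (hD : D < ⊤)
    (h : StrictConvexOn ℝ≥0 (Set.Icc (0 : ℝ≥0) 1) (fun t : ℝ≥0 =>
      2⁻¹ * (((1 - t : ℝ≥0) : ℝ≥0∞) ^ 2 * A + 2 * ((1 - t : ℝ≥0) : ℝ≥0∞) * t * B + t ^ 2 * D))) :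
    2 * B < A + D := by
  have h1 := h.2 (show (0 : ℝ≥0) ∈ Set.Icc (0 : ℝ≥0) 1 by simp)
    (show (1 : ℝ≥0) ∈ Set.Icc (0 : ℝ≥0) 1 by simp) zero_ne_one
    (show (0 : ℝ≥0) < 2⁻¹ by simp) (show (0 : ℝ≥0) < 2⁻¹ by simp) (by rw [← two_mul]; simp)
  have h3 : (1 - 2⁻¹ : ℝ≥0) = 2⁻¹ := by
    rw [tsub_eq_iff_eq_add_of_le (by rw [← NNReal.coe_le_coe]; norm_num), ← NNReal.coe_inj]
    norm_num
  have h2 : (2⁻¹ : ℝ≥0∞) = ((2⁻¹ : ℝ≥0) : ℝ≥0∞) := by simp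
  lift A to ℝ≥0 using hA.ne
  lift D to ℝ≥0 using hD.ne
  simp only [smul_eq_mul, mul_zero, mul_one, zero_add, h3, ENNReal.smul_def, h2] at h1
  have hB : B ≠ ⊤ := by
    rintro rfl
    simp [ENNReal.mul_top] at h1
  lift B to ℝ≥0 using hB
  simp only [tsub_zero, tsub_self] at h1
  norm_cast at h1 ⊢
  rw [← NNReal.coe_lt_coe] at h1 ⊢
  push_cast at h1 ⊢
  linarith

end MutualEnergy

/-! ### Cancellation of the quadratic part and reduction to the singular kernel. -/

lemma CompactlySupported.ae_mem {ρ : Measure R3} (h : CompactlySupported ρ) :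
    ∃ K : Set R3, IsCompact K ∧ ∀ᵐ x ∂ρ, x ∈ K := by
  obtain ⟨K, hK, hρ⟩ := h
  exact ⟨K, hK, hρ⟩

lemma CompactlySupported.integrable {ρ : Measure R3} [IsFiniteMeasure ρ]
    (h : CompactlySupported ρ) {E : Type*} [NormedAddCommGroup E] {f : R3 → E}
    (hf : Continuous f) : Integrable f ρ := by
  obtain ⟨K, hK, hρ⟩ := h.ae_mem
  have h1 : IntegrableOn f K ρ := hf.continuousOn.integrableOn_compact hK
  rwa [IntegrableOn, Measure.restrict_eq_self_of_ae_mem hρ] at h1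

lemma CompactlySupported.integral_inner_left {ρ : Measure R3} [IsFiniteMeasure ρ]
    (h : CompactlySupported ρ) (c : R3) : ∫ x, inner ℝ c x ∂ρ = inner ℝ c (∫ x, x ∂ρ) :=
  integral_inner (f := fun x => x) (h.integrable continuous_id) c

lemma CompactlySupported.integral_inner_right {ρ : Measure R3} [IsFiniteMeasure ρ]
    (h : CompactlySupported ρ) (c : R3) : ∫ x, inner ℝ x c ∂ρ = inner ℝ (∫ x, x ∂ρ) c := by
  rw [real_inner_comm, ← h.integral_inner_left]
  simp only [real_inner_comm]

lemma mutualEnergy_norm_sq {ρ σ : Measure R3} [IsProbabilityMeasure ρ] [IsProbabilityMeasure σ]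
    (hρ : CompactlySupported ρ) (hσ : CompactlySupported σ) :
    mutualEnergy (fun x => ENNReal.ofReal (‖x‖ ^ 2)) ρ σ =
      ENNReal.ofReal (∫ x, ‖x‖ ^ 2 ∂ρ + ∫ x, ‖x‖ ^ 2 ∂σ -
        2 * inner ℝ (∫ x, x ∂ρ) (∫ x, x ∂σ)) := by
  have h1 : ∀ x, ∫⁻ y, ENNReal.ofReal (‖x - y‖ ^ 2) ∂σ =
      ENNReal.ofReal (‖x‖ ^ 2 - 2 * inner ℝ x (∫ y, y ∂σ) + ∫ y, ‖y‖ ^ 2 ∂σ) := by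
    intro x
    rw [← ofReal_integral_eq_lintegral_ofReal (hσ.integrable (by fun_prop))
      (.of_forall fun y => by positivity)]
    congr 1
    simp only [norm_sub_sq_real]
    rw [integral_add (hσ.integrable (by fun_prop)) (hσ.integrable (by fun_prop)),
      integral_sub (hσ.integrable (by fun_prop)) (hσ.integrable (by fun_prop)),
      integral_const_mul, hσ.integral_inner_left]
    simp
  unfold mutualEnergy
  simp only [h1]
  have h2 : ∀ x : R3, 0 ≤ ‖x‖ ^ 2 - 2 * inner ℝ x (∫ y, y ∂σ) + ∫ y, ‖y‖ ^ 2 ∂σ := by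
    intro x
    have : 0 ≤ ∫ y, ‖x - y‖ ^ 2 ∂σ := integral_nonneg fun y => by positivity
    simp only [norm_sub_sq_real] at this
    rw [integral_add (hσ.integrable (by fun_prop)) (hσ.integrable (by fun_prop)),
      integral_sub (hσ.integrable (by fun_prop)) (hσ.integrable (by fun_prop)),
      integral_const_mul, hσ.integral_inner_left] at this
    simpa using this
  rw [← ofReal_integral_eq_lintegral_ofReal (hρ.integrable (by fun_prop)) (.of_forall h2)]
  congr 1
  rw [integral_add (hρ.integrable (by fun_prop)) (hρ.integrable (by fun_prop)),
    integral_sub (hρ.integrable (by fun_prop)) (hρ.integrable (by fun_prop)),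
    integral_const_mul, hρ.integral_inner_right]
  simp
  ring

/-- The singular part `‖x‖ ^ (-s) * Ω (x / ‖x‖)` of the potential, with value `+∞` at the
origin. -/
noncomputable def singularPotential (s : ℝ) (Ω : S2 → ℝ) (x : R3) : ℝ≥0∞ :=
  open Classical in if x = 0 then ⊤ else ENNReal.ofReal (homExt (-s) Ω x)

section SingularPotential

variable {s : ℝ} {Ω : S2 → ℝ}

lemma singularPotential_of_ne {x : R3} (hx : x ≠ 0) :
    singularPotential s Ω x = ENNReal.ofReal (homExt (-s) Ω x) := by
  simp [singularPotential, hx]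

lemma measurable_singularPotential (hΩ : Continuous Ω) : Measurable (singularPotential s Ω) := by
  classical
  have : singularPotential s Ω =
      fun x => if x ∈ ({0} : Set R3) then ⊤ else ENNReal.ofReal (homExt (-s) Ω x) := by
    ext x
    simp only [singularPotential, Set.mem_singleton_iff]
  rw [this]
  exact Measurable.ite (measurableSet_singleton 0) measurable_const
    (measurable_homExt _ hΩ).ennreal_ofReal

lemma singularPotential_neg (he : ∀ x, Ω (-x) = Ω x) (x : R3) :
    singularPotential s Ω (-x) = singularPotential s Ω x := by
  simp [singularPotential, homExt_neg he]

lemma potential_eq_add (hΩ : ∀ x, 0 ≤ Ω x) :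
    potential s Ω = singularPotential s Ω + fun x => ENNReal.ofReal (‖x‖ ^ 2) := by
  ext x
  by_cases hx : x = 0
  · simp [potential, singularPotential, hx]
  · simp only [potential, singularPotential, hx, if_false, Pi.add_apply]
    rw [ENNReal.ofReal_add (homExt_nonneg hΩ x) (by positivity)]

/-- For two measures with the same center of mass, strict convexity of the energy along their
linear interpolation only involves the singular part of the potential. -/
theorem strictConvexOn_interactionEnergy_iff (hΩ : ConditionH Ω) {ρ₀ ρ₁ : Measure R3}
    [IsProbabilityMeasure ρ₀] [IsProbabilityMeasure ρ₁] (h₀ : CompactlySupported ρ₀)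
    (h₁ : CompactlySupported ρ₁) (hc : ∫ x, x ∂ρ₀ = ∫ x, x ∂ρ₁)
    (hE₀ : mutualEnergy (singularPotential s Ω) ρ₀ ρ₀ < ⊤)
    (hE₁ : mutualEnergy (singularPotential s Ω) ρ₁ ρ₁ < ⊤) :
    StrictConvexOn ℝ≥0 (Set.Icc (0 : ℝ≥0) 1)
      (fun t : ℝ≥0 => interactionEnergy (potential s Ω) ((1 - t) • ρ₀ + t • ρ₁)) ↔
    2 * mutualEnergy (singularPotential s Ω) ρ₀ ρ₁ <
      mutualEnergy (singularPotential s Ω) ρ₀ ρ₀ + mutualEnergy (singularPotential s Ω) ρ₁ ρ₁ := by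
  have hu : Measurable (singularPotential s Ω) :=
    measurable_singularPotential hΩ.smooth.continuous
  have hm : Measurable (potential s Ω) := by
    rw [potential_eq_add fun x => (hΩ.pos x).le]
    exact hu.add (by fun_prop)
  have he : ∀ x, potential s Ω (-x) = potential s Ω x := fun x => by
    rw [potential_eq_add fun x => (hΩ.pos x).le]
    simp [singularPotential_neg hΩ.even]
  simp only [interactionEnergy_combination hm he]
  have hC : ∀ ρ σ : Measure R3, SFinite σ → mutualEnergy (potential s Ω) ρ σ =
      mutualEnergy (singularPotential s Ω) ρ σ +
        mutualEnergy (fun x => ENNReal.ofReal (‖x‖ ^ 2)) ρ σ := fun ρ σ _ => by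
    rw [potential_eq_add fun x => (hΩ.pos x).le, mutualEnergy_add hu]
  have hfin : ∀ ρ : Measure R3, IsProbabilityMeasure ρ → CompactlySupported ρ →
      mutualEnergy (singularPotential s Ω) ρ ρ < ⊤ → mutualEnergy (potential s Ω) ρ ρ < ⊤ := by
    intro ρ _ hρ h
    rw [hC _ _ inferInstance, mutualEnergy_norm_sq hρ hρ]
    exact ENNReal.add_lt_top.2 ⟨h, ENNReal.ofReal_lt_top⟩
  have hA := hfin ρ₀ inferInstance h₀ hE₀
  have hD := hfin ρ₁ inferInstance h₁ hE₁
  -- With common center c and second moments m₀, m₁, both sides equal 2 m₀ + 2 m₁ - 4 ‖c‖².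
  have hq : 2 * mutualEnergy (fun x => ENNReal.ofReal (‖x‖ ^ 2)) ρ₀ ρ₁ =
      mutualEnergy (fun x => ENNReal.ofReal (‖x‖ ^ 2)) ρ₀ ρ₀ +
        mutualEnergy (fun x => ENNReal.ofReal (‖x‖ ^ 2)) ρ₁ ρ₁ := by
    -- Variances are nonnegative, which lets `ENNReal.ofReal` split over the sums.
    have hnn : ∀ ρ : Measure R3, IsProbabilityMeasure ρ → CompactlySupported ρ →
        0 ≤ ∫ x, ‖x‖ ^ 2 ∂ρ - ‖∫ x, x ∂ρ‖ ^ 2 := by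
      intro ρ _ hρ
      have : 0 ≤ ∫ x, ‖x - ∫ y, y ∂ρ‖ ^ 2 ∂ρ := integral_nonneg fun y => by positivity
      simp only [norm_sub_sq_real] at this
      rw [integral_add (hρ.integrable (by fun_prop)) (hρ.integrable (by fun_prop)),
        integral_sub (hρ.integrable (by fun_prop)) (hρ.integrable (by fun_prop)),
        integral_const_mul, hρ.integral_inner_right, real_inner_self_eq_norm_sq] at this
      simp at this
      linarith
    have n₀ := hnn ρ₀ inferInstance h₀
    have n₁ := hnn ρ₁ inferInstance h₁
    rw [mutualEnergy_norm_sq h₀ h₁, mutualEnergy_norm_sq h₀ h₀, mutualEnergy_norm_sq h₁ h₁, hc,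
      real_inner_self_eq_norm_sq]
    rw [hc] at n₀
    rw [two_mul, ← ENNReal.ofReal_add (by linarith) (by linarith),
      ← ENNReal.ofReal_add (by linarith) (by linarith)]
    congr 1
    ring
  have hqf : 2 * mutualEnergy (fun x => ENNReal.ofReal (‖x‖ ^ 2)) ρ₀ ρ₁ ≠ ⊤ := by
    rw [mutualEnergy_norm_sq h₀ h₁]
    exact ENNReal.mul_ne_top (by simp) ENNReal.ofReal_ne_top
  have hiff : 2 * mutualEnergy (potential s Ω) ρ₀ ρ₁ <
      mutualEnergy (potential s Ω) ρ₀ ρ₀ + mutualEnergy (potential s Ω) ρ₁ ρ₁ ↔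
      2 * mutualEnergy (singularPotential s Ω) ρ₀ ρ₁ <
      mutualEnergy (singularPotential s Ω) ρ₀ ρ₀ + mutualEnergy (singularPotential s Ω) ρ₁ ρ₁ := by
    rw [hC _ _ inferInstance, hC _ _ inferInstance, hC _ _ inferInstance, mul_add,
      add_add_add_comm, ← hq]
    exact ENNReal.add_lt_add_iff_right hqf
  rw [← hiff]
  exact ⟨lt_of_strictConvexOn_quadratic hA hD, strictConvexOn_quadratic hA hD⟩

end SingularPotential

/-! ### Autocorrelations and the energy in Fourier variables. -/

/-- The autocorrelation of a real function on `R3`. -/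
noncomputable def autocorrelation (f : R3 → ℝ) (z : R3) : ℝ := ∫ y, f y * f (y - z)

lemma fourier_ofReal_neg (f : R3 → ℝ) (ξ : R3) :
    𝓕 (fun x => (f x : ℂ)) (-ξ) = (starRingEnd ℂ) (𝓕 (fun x => (f x : ℂ)) ξ) := by
  rw [Real.fourier_eq, Real.fourier_eq, ← integral_conj]
  congr 1
  ext x
  simp only [inner_neg_right, neg_neg, Circle.smul_def, smul_eq_mul, map_mul,
    Complex.conj_ofReal]
  congr 1
  rw [← Circle.coe_inv_eq_conj, ← AddChar.map_neg_eq_inv, neg_neg]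

lemma fourier_comp_neg (f : R3 → ℂ) (ξ : R3) :
    𝓕 (fun x => f (-x)) (-ξ) = 𝓕 f ξ := by
  rw [Real.fourier_eq, Real.fourier_eq, ← integral_neg_eq_self]
  congr 1
  ext x
  simp

lemma exists_schwartz_ofReal {f : R3 → ℝ} (hf : ContDiff ℝ ∞ f) (hs : HasCompactSupport f) :
    ∃ ψ : 𝓢(R3, ℂ), ∀ x, ψ x = f x :=
  ⟨(hs.comp_left (g := fun t : ℝ => (t : ℂ)) Complex.ofReal_zero).toSchwartzMap
    (Complex.ofRealCLM.contDiff.comp hf), fun _ => rfl⟩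

/-- An autocorrelation is the convolution of f with its reflection, and for real f the transforms of
these two are complex conjugates. -/
lemma exists_schwartz_fourier_eq_autocorrelation {f : R3 → ℝ} (hf : ContDiff ℝ ∞ f)
    (hs : HasCompactSupport f) :
    ∃ φ : 𝓢(R3, ℂ), (∀ z, (𝓕 φ) z = (autocorrelation f z : ℂ)) ∧
      ∀ ξ, φ ξ = ((‖𝓕 (fun x => (f x : ℂ)) ξ‖ ^ 2 : ℝ) : ℂ) := by
  obtain ⟨F, hF⟩ := exists_schwartz_ofReal hf hs
  obtain ⟨G, hG⟩ := exists_schwartz_ofReal (f := fun x => f (-x)) (hf.comp contDiff_neg)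
    (hs.comp_homeomorph (Homeomorph.neg R3))
  have hF' : ⇑F = fun x => (f x : ℂ) := funext hF
  have hG' : ⇑G = fun x => (f (-x) : ℂ) := funext hG
  refine ⟨𝓕⁻ (SchwartzMap.convolution (ContinuousLinearMap.mul ℂ ℂ) F G), fun z => ?_,
    fun ξ => ?_⟩
  · rw [FourierTransform.fourier_fourierInv_eq, SchwartzMap.convolution_apply, convolution,
      autocorrelation, ← integral_complex_ofReal]
    congr 1
    ext t
    simp [hF, hG]
  · have h1 : (𝓕⁻ (SchwartzMap.convolution (ContinuousLinearMap.mul ℂ ℂ) F G)) ξ =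
        (𝓕 (SchwartzMap.convolution (ContinuousLinearMap.mul ℂ ℂ) F G)) (-ξ) := by
      rw [SchwartzMap.fourierInv_coe, SchwartzMap.fourier_coe, Real.fourierInv_eq_fourier_neg]
    rw [h1, SchwartzMap.fourier_convolution_apply, Real.fourier_mul_convolution_eq
      F.integrable G.integrable, hF', hG', fourier_ofReal_neg f,
      fourier_comp_neg (fun x => (f x : ℂ)), mul_comm, Complex.mul_conj, Complex.normSq_eq_norm_sq]

/-- The defining identity is tested on |f̂|², whose transform is the autocorrelation. The sign of Ωt
thereby becomes visible in the energy. -/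
theorem IsFourierAngle.integral_mul_autocorrelation {s : ℝ} {Ω Ωt : S2 → ℝ}
    (h : IsFourierAngle s Ω Ωt) {f : R3 → ℝ} (hf : ContDiff ℝ ∞ f) (hs : HasCompactSupport f) :
    ∫ z, homExt (-s) Ω z * autocorrelation f z =
      ∫ ξ, homExt (-3 + s) Ωt ξ * ‖𝓕 (fun x => (f x : ℂ)) ξ‖ ^ 2 := by
  obtain ⟨φ, h1, h2⟩ := exists_schwartz_fourier_eq_autocorrelation hf hs
  have := h.2 φ
  simp only [h1, h2] at this
  rw [← Complex.ofReal_inj, ← integral_complex_ofReal, ← integral_complex_ofReal]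
  simpa only [Complex.ofReal_mul] using this

lemma autocorrelation_nonneg {f : R3 → ℝ} (hf : ∀ x, 0 ≤ f x) (z : R3) :
    0 ≤ autocorrelation f z :=
  integral_nonneg fun _ => mul_nonneg (hf _) (hf _)

lemma autocorrelation_eq_zero {f : R3 → ℝ} {r : ℝ} (hf : ∀ x, r < ‖x‖ → f x = 0) {z : R3}
    (hz : 2 * r < ‖z‖) : autocorrelation f z = 0 := by
  refine integral_eq_zero_of_ae (.of_forall fun y => ?_)
  by_cases hy : r < ‖y‖
  · simp [hf y hy]
  · have h1 : ‖z‖ ≤ ‖y‖ + ‖y - z‖ := by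
      have := norm_sub_le y (y - z)
      simpa using this
    have : r < ‖y - z‖ := by linarith
    simp [hf _ this]

/-! ### Bounded densities as test measures for the LIC property. -/

/-- Bounded measurable functions with bounded support. -/
structure IsBoundedDensity (f : R3 → ℝ) : Prop where
  measurable : Measurable f
  bounded : ∃ C, ∀ x, |f x| ≤ C
  support : ∃ r, ∀ x, r < ‖x‖ → f x = 0

/-- The cross-correlation of two real functions on `R3`. -/
noncomputable def crossCorrelation (f g : R3 → ℝ) (z : R3) : ℝ := ∫ x, f x * g (x - z)

lemma integral_add_sub_sub {a b c d : R3 → ℝ} (ha : Integrable a) (hb : Integrable b)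
    (hc : Integrable c) (hd : Integrable d) :
    ∫ x, (a x + b x - c x - d x) =
      (∫ x, a x) + (∫ x, b x) - (∫ x, c x) - ∫ x, d x := by
  rw [integral_sub (f := fun x => a x + b x - c x) ((ha.add hb).sub hc) hd,
    integral_sub (f := fun x => a x + b x) (ha.add hb) hc, integral_add ha hb]

section BoundedDensity

variable {f g : R3 → ℝ}

lemma Continuous.isBoundedDensity (hf : Continuous f) (hs : HasCompactSupport f) :
    IsBoundedDensity f where
  measurable := hf.measurable
  bounded := hs.exists_bound_of_continuous hf
  support := by
    obtain ⟨r, hr⟩ := hs.isCompact.isBounded.subset_closedBall 0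
    refine ⟨r, fun x hx => ?_⟩
    by_contra h
    have := hr (subset_tsupport f h)
    rw [mem_closedBall_zero_iff] at this
    linarith

namespace IsBoundedDensity

lemma add (hf : IsBoundedDensity f) (hg : IsBoundedDensity g) :
    IsBoundedDensity (fun x => f x + g x) := by
  obtain ⟨C, hC⟩ := hf.bounded
  obtain ⟨D, hD⟩ := hg.bounded
  obtain ⟨a, ha⟩ := hf.support
  obtain ⟨b, hb⟩ := hg.support
  refine ⟨hf.measurable.add hg.measurable,
    ⟨C + D, fun x => (abs_add_le _ _).trans (add_le_add (hC x) (hD x))⟩, max a b, fun x hx => ?_⟩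
  rw [ha x (lt_of_le_of_lt (le_max_left _ _) hx), hb x (lt_of_le_of_lt (le_max_right _ _) hx),
    add_zero]

lemma const_mul (hf : IsBoundedDensity f) (c : ℝ) : IsBoundedDensity (fun x => c * f x) := by
  obtain ⟨C, hC⟩ := hf.bounded
  obtain ⟨a, ha⟩ := hf.support
  refine ⟨hf.measurable.const_mul c, ⟨|c| * C, fun x => ?_⟩, a, fun x hx => by simp [ha x hx]⟩
  rw [abs_mul]
  exact mul_le_mul_of_nonneg_left (hC x) (abs_nonneg c)

lemma integrable_smul (hf : IsBoundedDensity f) {E : Type*} [NormedAddCommGroup E]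
    [NormedSpace ℝ E] [SecondCountableTopology E] {k : R3 → E} (hk : Continuous k) :
    Integrable (fun x => f x • k x) := by
  obtain ⟨C, hC⟩ := hf.bounded
  obtain ⟨a, ha⟩ := hf.support
  have h1 : IntegrableOn (fun x => f x • k x) (closedBall (0 : R3) a) := by
    have : IntegrableOn k (closedBall (0 : R3) a) :=
      hk.continuousOn.integrableOn_compact (isCompact_closedBall 0 a)
    exact Integrable.bdd_smul (𝕜 := ℝ) this C hf.measurable.aestronglyMeasurable
      (.of_forall hC)
  rw [← integrableOn_univ]
  refine h1.of_forall_sdiff_eq_zero MeasurableSet.univ fun x hx => ?_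
  have : a < ‖x‖ := by simpa using hx.2
  simp [ha x this]

lemma integrable (hf : IsBoundedDensity f) : Integrable f := by
  simpa using hf.integrable_smul (continuous_const (y := (1 : ℝ)))

lemma integrable_mul_sub (hf : IsBoundedDensity f) (hg : IsBoundedDensity g) (z : R3) :
    Integrable (fun x => f x * g (x - z)) := by
  obtain ⟨C, hC⟩ := hg.bounded
  exact hf.integrable.mul_bdd (c := C)
    (hg.measurable.comp (measurable_id.sub_const z)).aestronglyMeasurable
    (.of_forall fun x => hC _)

lemma crossCorrelation (hf : IsBoundedDensity f) (hg : IsBoundedDensity g) :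
    IsBoundedDensity (crossCorrelation f g) := by
  obtain ⟨C, hC⟩ := hg.bounded
  obtain ⟨a, ha⟩ := hf.support
  obtain ⟨b, hb⟩ := hg.support
  refine ⟨?_, ⟨(∫ x, |f x|) * C, fun z => ?_⟩, a + b, fun z hz => ?_⟩
  · have h : StronglyMeasurable fun p : R3 × R3 => f p.2 * g (p.2 - p.1) :=
      ((hf.measurable.comp measurable_snd).mul
        (hg.measurable.comp (measurable_snd.sub measurable_fst))).stronglyMeasurable
    exact h.integral_prod_right.measurable
  · rw [← integral_mul_const, ← Real.norm_eq_abs]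
    refine (norm_integral_le_integral_norm _).trans (integral_mono
      (hf.integrable_mul_sub hg z).norm (hf.integrable.abs.mul_const C) fun x => ?_)
    rw [Real.norm_eq_abs, abs_mul]
    exact mul_le_mul_of_nonneg_left (hC _) (abs_nonneg _)
  · refine integral_eq_zero_of_ae (.of_forall fun y => ?_)
    by_cases hy : a < ‖y‖
    · simp [ha y hy]
    · have h1 : ‖z‖ ≤ ‖y‖ + ‖y - z‖ := by simpa using norm_sub_le y (y - z)
      have : b < ‖y - z‖ := by linarith
      simp [hb _ this]

lemma integrable_homExt_mul {p : ℝ} (hp : -3 < p) {Ω : S2 → ℝ} (hΩ : Continuous Ω)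
    (hf : IsBoundedDensity f) : Integrable (fun z => homExt p Ω z * f z) := by
  obtain ⟨C, hC⟩ := hf.bounded
  obtain ⟨a, ha⟩ := hf.support
  have h1 : IntegrableOn (fun z => homExt p Ω z * f z) (ball (0 : R3) (a + 1)) :=
    Integrable.mul_bdd (c := C) (integrableOn_homExt_ball hp hΩ (a + 1))
      hf.measurable.aestronglyMeasurable (.of_forall fun x => hC _)
  rw [← integrableOn_univ]
  refine h1.of_forall_sdiff_eq_zero MeasurableSet.univ fun x hx => ?_
  have : a + 1 ≤ ‖x‖ := by simpa using hx.2
  rw [ha x (by linarith), mul_zero]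

/-- The measure with density `f`. -/
noncomputable def toMeasure (_ : IsBoundedDensity f) : Measure R3 :=
  volume.withDensity fun x => ENNReal.ofReal (f x)

lemma isProbabilityMeasure_toMeasure (hf : IsBoundedDensity f) (h0 : ∀ x, 0 ≤ f x)
    (h1 : ∫ x, f x = 1) : IsProbabilityMeasure hf.toMeasure := by
  refine ⟨?_⟩
  rw [toMeasure, withDensity_apply _ MeasurableSet.univ, Measure.restrict_univ,
    ← ofReal_integral_eq_lintegral_ofReal hf.integrable (.of_forall h0), h1, ENNReal.ofReal_one]

lemma compactlySupported_toMeasure (hf : IsBoundedDensity f) :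
    CompactlySupported hf.toMeasure := by
  obtain ⟨a, ha⟩ := hf.support
  refine ⟨closedBall 0 a, isCompact_closedBall 0 a, ?_⟩
  rw [toMeasure, withDensity_apply _ isClosed_closedBall.measurableSet.compl]
  refine setLIntegral_eq_zero isClosed_closedBall.measurableSet.compl fun x hx => ?_
  have : a < ‖x‖ := by simpa using hx
  simp [ha x this]

lemma integral_toMeasure (hf : IsBoundedDensity f) (h0 : ∀ x, 0 ≤ f x) :
    ∫ x, x ∂hf.toMeasure = ∫ x, f x • x := by
  rw [toMeasure, integral_withDensity_eq_integral_toReal_smul hf.measurable.ennreal_ofReal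
    (.of_forall fun x => ENNReal.ofReal_lt_top)]
  simp only [ENNReal.toReal_ofReal (h0 _)]

/-- Substitute z = x - y and apply Tonelli. The kernels with values +∞ and 0 at the origin differ
only on a null set. -/
theorem mutualEnergy_toMeasure {s : ℝ} (hs3 : s < 3) {Ω : S2 → ℝ} (hΩ : ConditionH Ω)
    (hf : IsBoundedDensity f) (hg : IsBoundedDensity g) (hf0 : ∀ x, 0 ≤ f x)
    (hg0 : ∀ x, 0 ≤ g x) :
    mutualEnergy (singularPotential s Ω) hf.toMeasure hg.toMeasure =
      ENNReal.ofReal (∫ z, homExt (-s) Ω z * _root_.crossCorrelation f g z) := by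
  have hu : Measurable (singularPotential s Ω) :=
    measurable_singularPotential hΩ.smooth.continuous
  have hfm := hf.measurable.ennreal_ofReal
  have hgm := hg.measurable.ennreal_ofReal
  have hm : Measurable fun p : R3 × R3 => singularPotential s Ω (p.1 - p.2) :=
    hu.comp (measurable_fst.sub measurable_snd)
  unfold mutualEnergy toMeasure
  rw [lintegral_withDensity_eq_lintegral_mul _ hfm (by
    exact hm.lintegral_prod_right' (ν := volume.withDensity fun x => ENNReal.ofReal (g x)))]
  calc _ = ∫⁻ x, ∫⁻ z, ENNReal.ofReal (f x * g (x - z)) * singularPotential s Ω z := by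
        congr 1
        ext x
        rw [Pi.mul_apply, lintegral_withDensity_eq_lintegral_mul _ hgm
          (show Measurable fun y => singularPotential s Ω (x - y) from
            hm.comp measurable_prodMk_left), ← lintegral_sub_left_eq_self _ x,
          ← lintegral_const_mul]
        · congr 1
          ext z
          simp only [Pi.mul_apply, sub_sub_cancel]
          rw [ENNReal.ofReal_mul (hf0 x), mul_assoc]
        · exact ((hgm.mul (hm.comp measurable_prodMk_left))).comp (measurable_const.sub measurable_id)
    _ = ∫⁻ z, ∫⁻ x, ENNReal.ofReal (f x * g (x - z)) * singularPotential s Ω z := by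
        refine lintegral_lintegral_swap (Measurable.aemeasurable ?_)
        exact (((hf.measurable.comp measurable_fst).mul
          (hg.measurable.comp (measurable_fst.sub measurable_snd))).ennreal_ofReal).mul
          (hu.comp measurable_snd)
    _ = ∫⁻ z, ENNReal.ofReal (homExt (-s) Ω z * _root_.crossCorrelation f g z) := by
        have h0 : ∀ᵐ z : R3, z ≠ 0 := by simp [ae_iff]
        refine lintegral_congr_ae (h0.mono fun z hz => ?_)
        simp only
        rw [lintegral_mul_const'' _ (hf.integrable_mul_sub hg z).aemeasurable.ennreal_ofReal,
          ← ofReal_integral_eq_lintegral_ofReal (hf.integrable_mul_sub hg z)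
            (.of_forall fun x => mul_nonneg (hf0 _) (hg0 _)),
          singularPotential_of_ne hz, mul_comm,
          ← ENNReal.ofReal_mul (homExt_nonneg (fun x => (hΩ.pos x).le) z)]
        rfl
    _ = _ := by
        rw [ofReal_integral_eq_lintegral_ofReal
          ((hf.crossCorrelation hg).integrable_homExt_mul (by linarith) hΩ.smooth.continuous)
          (.of_forall fun z => mul_nonneg (homExt_nonneg (fun x => (hΩ.pos x).le) z)
            (integral_nonneg fun x => mul_nonneg (hf0 _) (hg0 _)))]

end IsBoundedDensity

lemma autocorrelation_sub (hf : IsBoundedDensity f) (hg : IsBoundedDensity g) (z : R3) :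
    autocorrelation (fun x => g x - f x) z = crossCorrelation f f z + crossCorrelation g g z -
      crossCorrelation f g z - crossCorrelation g f z := by
  unfold autocorrelation crossCorrelation
  rw [← integral_add_sub_sub (hf.integrable_mul_sub hf z) (hg.integrable_mul_sub hg z)
    (hf.integrable_mul_sub hg z) (hg.integrable_mul_sub hf z)]
  congr 1
  ext x
  ring

lemma autocorrelation_const_mul (c : ℝ) (f : R3 → ℝ) (z : R3) :
    autocorrelation (fun x => c * f x) z = c ^ 2 * autocorrelation f z := by
  unfold autocorrelation
  rw [← integral_const_mul]
  congr 1
  ext x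
  ring

/-- Under the LIC property, two bounded probability densities with the same center of mass have
a difference of nonnegative energy. -/
lemma HasLIC.integral_mul_autocorrelation_sub_nonneg {s : ℝ} (hs3 : s < 3)
    {Ω : S2 → ℝ} (hΩ : ConditionH Ω) (hL : HasLIC (potential s Ω)) (hf : IsBoundedDensity f)
    (hg : IsBoundedDensity g) (hf0 : ∀ x, 0 ≤ f x) (hg0 : ∀ x, 0 ≤ g x) (hf1 : ∫ x, f x = 1)
    (hg1 : ∫ x, g x = 1) (hc : ∫ x, f x • x = ∫ x, g x • x) :
    0 ≤ ∫ z, homExt (-s) Ω z * autocorrelation (fun x => g x - f x) z := by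
  have hpf := hf.isProbabilityMeasure_toMeasure hf0 hf1
  have hpg := hg.isProbabilityMeasure_toMeasure hg0 hg1
  have e := fun {f g : R3 → ℝ} (hf : IsBoundedDensity f) (hg : IsBoundedDensity g) =>
    hf.mutualEnergy_toMeasure hs3 hΩ hg
  have nn : ∀ {f g : R3 → ℝ}, (∀ x, 0 ≤ f x) → (∀ x, 0 ≤ g x) →
      0 ≤ ∫ z, homExt (-s) Ω z * crossCorrelation f g z := fun hf0 hg0 =>
    integral_nonneg fun z => mul_nonneg (homExt_nonneg (fun x => (hΩ.pos x).le) z)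
      (integral_nonneg fun x => mul_nonneg (hf0 _) (hg0 _))
  have hfin : ∀ {f : R3 → ℝ} (hf : IsBoundedDensity f), (∀ x, 0 ≤ f x) →
      mutualEnergy (singularPotential s Ω) hf.toMeasure hf.toMeasure < ⊤ := fun hf hf0 => by
    rw [e hf hf hf0 hf0]; exact ENNReal.ofReal_lt_top
  have key : 2 * mutualEnergy (singularPotential s Ω) hf.toMeasure hg.toMeasure ≤
      mutualEnergy (singularPotential s Ω) hf.toMeasure hf.toMeasure +
        mutualEnergy (singularPotential s Ω) hg.toMeasure hg.toMeasure := by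
    -- LIC says nothing about equal measures, but the weak inequality is then an equality.
    by_cases hne : hf.toMeasure = hg.toMeasure
    · rw [hne, two_mul]
    have hcm : ∫ x, x ∂hf.toMeasure = ∫ x, x ∂hg.toMeasure := by
      rw [hf.integral_toMeasure hf0, hg.integral_toMeasure hg0, hc]
    have hE : ∀ {f : R3 → ℝ} (hf : IsBoundedDensity f), (∀ x, 0 ≤ f x) → (∫ x, f x = 1) →
        interactionEnergy (potential s Ω) hf.toMeasure < ⊤ := fun hf hf0 hf1 => by
      have := hf.isProbabilityMeasure_toMeasure hf0 hf1
      rw [mutualEnergy_self_lt_top_iff, potential_eq_add fun x => (hΩ.pos x).le,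
        mutualEnergy_add (measurable_singularPotential hΩ.smooth.continuous),
        mutualEnergy_norm_sq hf.compactlySupported_toMeasure hf.compactlySupported_toMeasure]
      exact ENNReal.add_lt_top.2 ⟨hfin hf hf0, ENNReal.ofReal_lt_top⟩
    have h := hL _ _ hpf hpg hf.compactlySupported_toMeasure hg.compactlySupported_toMeasure hne
      hcm (hE hf hf0 hf1) (hE hg hg0 hg1)
    exact ((strictConvexOn_interactionEnergy_iff hΩ hf.compactlySupported_toMeasure
      hg.compactlySupported_toMeasure hcm (hfin hf hf0) (hfin hg hg0)).1 h).le
  have hcomm : ∫ z, homExt (-s) Ω z * crossCorrelation f g z =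
      ∫ z, homExt (-s) Ω z * crossCorrelation g f z := by
    have := mutualEnergy_comm (measurable_singularPotential (s := s) hΩ.smooth.continuous)
      (singularPotential_neg hΩ.even) (ρ := hf.toMeasure) (σ := hg.toMeasure)
    rwa [e hf hg hf0 hg0, e hg hf hg0 hf0, ENNReal.ofReal_eq_ofReal_iff (nn hf0 hg0)
      (nn hg0 hf0)] at this
  rw [e hf hg hf0 hg0, e hf hf hf0 hf0, e hg hg hg0 hg0, two_mul,
    ← ENNReal.ofReal_add (nn hf0 hg0) (nn hf0 hg0), ← ENNReal.ofReal_add (nn hf0 hf0) (nn hg0 hg0),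
    ENNReal.ofReal_le_ofReal_iff (add_nonneg (nn hf0 hf0) (nn hg0 hg0))] at key
  have hi := fun {f g : R3 → ℝ} (hf : IsBoundedDensity f) (hg : IsBoundedDensity g) =>
    (hf.crossCorrelation hg).integrable_homExt_mul (p := -s) (by linarith) hΩ.smooth.continuous
  simp only [autocorrelation_sub hf hg, mul_sub, mul_add]
  rw [integral_add_sub_sub (hi hf hf) (hi hg hg) (hi hf hg) (hi hg hf)]
  linarith

/-- Under the LIC property, the energy is nonnegative on neutral densities with vanishing first
moment. -/
theorem HasLIC.integral_mul_autocorrelation_nonneg {s : ℝ} (hs3 : s < 3)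
    {Ω : S2 → ℝ} (hΩ : ConditionH Ω) (hL : HasLIC (potential s Ω)) {μ : R3 → ℝ}
    (hμ : IsBoundedDensity μ) (h0 : ∫ x, μ x = 0) (h1 : ∫ x, μ x • x = 0) :
    0 ≤ ∫ z, homExt (-s) Ω z * autocorrelation μ z := by
  obtain ⟨C', hC'⟩ := hμ.bounded
  obtain ⟨r', hr'⟩ := hμ.support
  obtain ⟨C, hC0, hC⟩ : ∃ C, 0 < C ∧ ∀ x, |μ x| ≤ C :=
    ⟨max C' 1, by positivity, fun x => (hC' x).trans (le_max_left _ _)⟩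
  obtain ⟨r, hr0, hr⟩ : ∃ r, 0 < r ∧ ∀ x, r ≤ ‖x‖ → μ x = 0 :=
    ⟨max (r' + 1) 1, by positivity,
      fun x hx => hr' x (by linarith [le_max_left (r' + 1) 1])⟩
  set v : ℝ := volume.real (ball (0 : R3) r) with hv
  have hv0 : 0 < v := ENNReal.toReal_pos (measure_ball_pos _ _ hr0).ne' measure_ball_lt_top.ne
  -- The reference density is uniform on a ball outside which μ vanishes.
  let f : R3 → ℝ := (ball (0 : R3) r).indicator fun _ => v⁻¹
  have hf : IsBoundedDensity f := by
    refine ⟨measurable_const.indicator measurableSet_ball, ⟨v⁻¹, fun x => ?_⟩, r, fun x hx => ?_⟩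
    · by_cases hx : x ∈ ball (0 : R3) r
      · simp [f, Set.indicator_of_mem hx, abs_of_pos hv0]
      · simp only [f, Set.indicator_of_notMem hx, abs_zero]
        positivity
    · exact Set.indicator_of_notMem (by simpa using hx.le) _
  have hf0 : ∀ x, 0 ≤ f x := fun x => Set.indicator_nonneg (fun _ _ => by positivity) x
  have hf1 : ∫ x, f x = 1 := by
    rw [integral_indicator measurableSet_ball, setIntegral_const, ← hv, smul_eq_mul,
      mul_inv_cancel₀ hv0.ne']
  -- With this δ one has |δ μ| ≤ v⁻¹, so the perturbed density stays nonnegative; its mass and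
  -- center are unchanged by the moment conditions on μ.
  set δ : ℝ := (v * C)⁻¹
  have hδ : 0 < δ := by positivity
  have hg : IsBoundedDensity (fun x => f x + δ * μ x) := hf.add (hμ.const_mul δ)
  have hg0 : ∀ x, 0 ≤ f x + δ * μ x := by
    intro x
    by_cases hx : x ∈ ball (0 : R3) r
    · simp only [f, Set.indicator_of_mem hx]
      have h2 : -(δ * C) ≤ δ * μ x := by
        rw [← mul_neg]
        exact mul_le_mul_of_nonneg_left (neg_le_of_abs_le (hC x)) hδ.le
      have h3 : δ * C = v⁻¹ := by simp only [δ]; field_simp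
      linarith
    · rw [hr x (by simpa using hx), mul_zero, add_zero]
      exact hf0 x
  have hg1 : ∫ x, f x + δ * μ x = 1 := by
    rw [integral_add hf.integrable (hμ.integrable.const_mul δ), integral_const_mul, h0, hf1]
    simp
  have hc : ∫ x, f x • x = ∫ x, (f x + δ * μ x) • x := by
    simp only [add_smul, mul_smul]
    rw [integral_add (f := fun x => f x • x) (g := fun x => δ • μ x • x)
      (hf.integrable_smul continuous_id) ((hμ.integrable_smul continuous_id).smul δ),
      integral_smul, h1]
    simp
  have := hL.integral_mul_autocorrelation_sub_nonneg hs3 hΩ hf hg hf0 hg0 hf1 hg1 hc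
  simp only [add_sub_cancel_left, autocorrelation_const_mul] at this
  have h4 : ∫ z, homExt (-s) Ω z * (δ ^ 2 * autocorrelation μ z) =
      δ ^ 2 * ∫ z, homExt (-s) Ω z * autocorrelation μ z := by
    rw [← integral_const_mul]
    congr 1
    ext z
    ring
  rw [h4] at this
  exact nonneg_of_mul_nonneg_right this (by positivity)

end BoundedDensity

/-! ### Directional derivatives: a supply of densities with vanishing moments. -/

/-- The directional derivative of a real function on `R3`. -/
noncomputable def directionalDeriv (e : R3) (f : R3 → ℝ) (x : R3) : ℝ := fderiv ℝ f x e

section DirectionalDeriv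

variable {f : R3 → ℝ} {e : R3}

lemma contDiff_directionalDeriv (hf : ContDiff ℝ ∞ f) : ContDiff ℝ ∞ (directionalDeriv e f) :=
  (hf.fderiv_right (m := ∞) (by simp)).clm_apply contDiff_const

lemma hasCompactSupport_directionalDeriv (hs : HasCompactSupport f) :
    HasCompactSupport (directionalDeriv e f) :=
  hs.fderiv_apply ℝ e

lemma fourier_directionalDeriv (hf : ContDiff ℝ ∞ f) (hs : HasCompactSupport f) (ξ : R3) :
    𝓕 (fun x => (directionalDeriv e f x : ℂ)) ξ =
      2 * Real.pi * Complex.I * inner ℝ ξ e * 𝓕 (fun x => (f x : ℂ)) ξ := by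
  obtain ⟨F, hF⟩ := exists_schwartz_ofReal hf hs
  have hF' : ⇑F = fun x => (f x : ℂ) := funext hF
  have h := congrArg (fun ψ : 𝓢(R3, ℂ) => ψ ξ) (SchwartzMap.fourier_lineDerivOp_eq F e)
  have h1 : ⇑(LineDeriv.lineDerivOp e F : 𝓢(R3, ℂ)) =
      fun x => (directionalDeriv e f x : ℂ) := by
    ext x
    rw [SchwartzMap.lineDerivOp_apply_eq_fderiv, hF']
    have : HasFDerivAt (fun x => (f x : ℂ)) (Complex.ofRealCLM.comp (fderiv ℝ f x)) x :=
      Complex.ofRealCLM.hasFDerivAt.comp x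
        (hf.differentiable (by simp)).differentiableAt.hasFDerivAt
    rw [this.fderiv]
    rfl
  simp only [SchwartzMap.fourier_coe, h1, smul_apply] at h
  rw [h, SchwartzMap.smulLeftCLM_apply_apply (by fun_prop), SchwartzMap.fourier_coe, hF']
  simp only [smul_eq_mul, Complex.real_smul]
  ring

/-- The integral is the transform at frequency 0, where the factor ⟨ξ, e⟩ vanishes. -/
lemma integral_directionalDeriv (hf : ContDiff ℝ ∞ f) (hs : HasCompactSupport f) :
    ∫ x, directionalDeriv e f x = 0 := by
  have h := fourier_directionalDeriv (e := e) hf hs 0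
  rw [Real.fourier_eq] at h
  simp only [inner_zero_right, neg_zero, AddChar.map_zero_eq_one, one_smul, inner_zero_left,
    Complex.ofReal_zero, mul_zero, zero_mul] at h
  rw [integral_complex_ofReal] at h
  exact_mod_cast h

/-- Pairing with w and integrating by parts turns the first moment into -⟨w, e⟩ ∫ f. -/
lemma integral_directionalDeriv_smul (hf : ContDiff ℝ ∞ f) (hs : HasCompactSupport f)
    (h0 : ∫ x, f x = 0) : ∫ x, directionalDeriv e f x • x = 0 := by
  have hfi : Integrable f := hf.continuous.integrable_of_hasCompactSupport hs
  have hd := hasCompactSupport_directionalDeriv (e := e) hs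
  have hdc := (contDiff_directionalDeriv (e := e) hf).continuous
  have hi : Integrable fun x => directionalDeriv e f x • x :=
    (hdc.isBoundedDensity hd).integrable_smul continuous_id
  refine ext_inner_left ℝ fun w => ?_
  rw [← integral_inner hi, inner_zero_right]
  have hw : ∀ x : R3, HasFDerivAt (fun x => inner ℝ w x) (innerSL ℝ w) x :=
    fun x => (innerSL ℝ w).hasFDerivAt
  have h := integral_mul_fderiv_eq_neg_fderiv_mul_of_integrable (μ := (volume : Measure R3))
    (f := fun x => inner ℝ w x) (g := f) (v := e) ?_ ?_ ?_ (fun x _ => (hw x).differentiableAt)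
    (fun x _ => hf.differentiable (by simp) x)
  · simp only [(hw _).fderiv, innerSL_apply_apply] at h
    rw [integral_const_mul, h0, mul_zero, neg_zero] at h
    rw [← h]
    congr 1
    ext x
    rw [inner_smul_right, mul_comm]
    rfl
  · simp only [(hw _).fderiv]
    exact hfi.const_mul _
  · have : Integrable fun x => directionalDeriv e f x * inner ℝ w x :=
      (hdc.isBoundedDensity hd).integrable_smul (by fun_prop)
    exact this.congr (.of_forall fun x => mul_comm _ _)
  · have : Integrable fun x => f x * inner ℝ w x :=
      (hf.continuous.isBoundedDensity hs).integrable_smul (by fun_prop)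
    simpa only [mul_comm] using this

end DirectionalDeriv

/-! ### Necessity: the weighted Fourier form and its localization in frequency. -/

section Modulation

variable {s : ℝ} {Ω Ωt : S2 → ℝ}

/-- The Fourier multiplier of the energy of second directional derivatives. -/
noncomputable def weight (s : ℝ) (Ωt : S2 → ℝ) (e ξ : R3) : ℝ :=
  homExt (-3 + s) Ωt ξ * inner ℝ ξ e ^ 4

/-- Each derivative kills one more moment, so a second derivative of any test function is
admissible; its squared transform carries the factor (2π)⁴ ⟨ξ, e⟩⁴. -/
lemma HasLIC.integral_weight_mul_nonneg (hs3 : s < 3) (hΩ : ConditionH Ω)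
    (hL : HasLIC (potential s Ω)) (h : IsFourierAngle s Ω Ωt) (e : R3) {f : R3 → ℝ}
    (hf : ContDiff ℝ ∞ f) (hs : HasCompactSupport f) :
    0 ≤ ∫ ξ, weight s Ωt e ξ * ‖𝓕 (fun x => (f x : ℂ)) ξ‖ ^ 2 := by
  have hf1 := contDiff_directionalDeriv (e := e) hf
  have hs1 := hasCompactSupport_directionalDeriv (e := e) hs
  have hf2 := contDiff_directionalDeriv (e := e) hf1
  have hs2 := hasCompactSupport_directionalDeriv (e := e) hs1
  have h1 := hL.integral_mul_autocorrelation_nonneg hs3 hΩ (hf2.continuous.isBoundedDensity hs2)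
    (integral_directionalDeriv hf1 hs1)
    (integral_directionalDeriv_smul hf1 hs1 (integral_directionalDeriv hf hs))
  rw [h.integral_mul_autocorrelation hf2 hs2] at h1
  have h2 : ∀ ξ, homExt (-3 + s) Ωt ξ *
      ‖𝓕 (fun x => (directionalDeriv e (directionalDeriv e f) x : ℂ)) ξ‖ ^ 2 =
      (2 * Real.pi) ^ 4 * (weight s Ωt e ξ * ‖𝓕 (fun x => (f x : ℂ)) ξ‖ ^ 2) := by
    intro ξ
    rw [fourier_directionalDeriv hf1 hs1, fourier_directionalDeriv hf hs, weight]
    simp only [norm_mul, Complex.norm_I, Complex.norm_real, Complex.norm_ofNat, Real.norm_eq_abs,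
      mul_pow, sq_abs]
    ring
  simp only [h2] at h1
  rw [integral_const_mul] at h1
  exact nonneg_of_mul_nonneg_right h1 (by positivity)

lemma weight_smul {t : ℝ} (ht : 0 < t) (e ξ : R3) :
    weight s Ωt e (t • ξ) = t ^ (s + 1) * weight s Ωt e ξ := by
  rw [weight, homExt_smul _ _ ht, inner_smul_left, weight]
  have : t ^ (s + 1) = t ^ (-3 + s) * t ^ 4 := by
    rw [← Real.rpow_natCast, ← Real.rpow_add ht]
    congr 1
    push_cast
    ring
  rw [this]
  simp only [conj_trivial]
  ring

lemma abs_weight_le (hs0 : 0 < s) (hs3 : s < 3) {M : ℝ} (hM0 : 0 ≤ M) (hM : ∀ x, |Ωt x| ≤ M)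
    {e : R3} (he : ‖e‖ = 1) (ξ : R3) : |weight s Ωt e ξ| ≤ M * (1 + ‖ξ‖) ^ 4 := by
  have h1 : |inner ℝ ξ e| ≤ ‖ξ‖ := by simpa [he] using abs_real_inner_le_norm ξ e
  by_cases hξ : ξ = 0
  · simp [weight, hξ, homExt_zero]
    exact hM0
  have hn := norm_pos_iff.2 hξ
  rw [weight, abs_mul, abs_pow]
  calc |homExt (-3 + s) Ωt ξ| * |inner ℝ ξ e| ^ 4
      ≤ (M * ‖ξ‖ ^ (-3 + s)) * ‖ξ‖ ^ 4 := by
        gcongr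
        exact abs_homExt_le hM0 hM ξ
    _ = M * ‖ξ‖ ^ (s + 1) := by
        rw [mul_assoc, ← Real.rpow_natCast, ← Real.rpow_add hn]
        congr 2
        push_cast
        ring
    _ ≤ M * (1 + ‖ξ‖) ^ (s + 1) := by
        gcongr
        linarith
    -- The exponent s + 1 is at most 4 because s < 3.
    _ ≤ M * (1 + ‖ξ‖) ^ (4 : ℝ) := by
        gcongr <;> linarith
    _ = _ := by norm_cast

lemma measurable_weight (hΩt : Continuous Ωt) (e : R3) : Measurable (weight s Ωt e) :=
  (measurable_homExt _ hΩt).mul (by fun_prop)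

lemma integrable_one_add_norm_pow_mul_sq (ψ : 𝓢(R3, ℂ)) :
    Integrable fun x => (1 + ‖x‖) ^ 4 * ‖ψ x‖ ^ 2 := by
  obtain ⟨C, hC0, hC⟩ := ψ.exists_norm_le_one_add_rpow_neg 4
  have h4 : Integrable fun x : R3 => C ^ 2 * (1 + ‖x‖) ^ (-4 : ℝ) :=
    (integrable_one_add_norm (by simp; norm_num)).const_mul _
  refine h4.mono' (Continuous.aestronglyMeasurable (by fun_prop)) (.of_forall fun x => ?_)
  have h1 : (0 : ℝ) < 1 + ‖x‖ := by positivity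
  rw [Real.norm_of_nonneg (by positivity)]
  calc (1 + ‖x‖) ^ 4 * ‖ψ x‖ ^ 2 ≤
        (1 + ‖x‖) ^ 4 * (C * (1 + ‖x‖) ^ (-((4 : ℕ) : ℝ))) ^ 2 := by
        gcongr
        exact hC x
    _ = C ^ 2 * (1 + ‖x‖) ^ (-4 : ℝ) := by
        rw [mul_pow, Real.rpow_neg h1.le, Real.rpow_neg h1.le, Real.rpow_natCast]
        norm_cast
        field_simp

lemma integrable_weight_mul (hs0 : 0 < s) (hs3 : s < 3) (hΩt : Continuous Ωt) {e : R3}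
    (he : ‖e‖ = 1) (ψ : 𝓢(R3, ℂ)) : Integrable fun ξ => weight s Ωt e ξ * ‖ψ ξ‖ ^ 2 := by
  obtain ⟨M, hM0, hM⟩ := exists_bound_of_continuous_sphere hΩt
  refine ((integrable_one_add_norm_pow_mul_sq ψ).const_mul M).mono'
    ((measurable_weight hΩt e).mul (by fun_prop)).aestronglyMeasurable (.of_forall fun ξ => ?_)
  rw [norm_mul, Real.norm_eq_abs, norm_pow, norm_norm, ← mul_assoc]
  gcongr
  exact abs_weight_le hs0 hs3 hM0.le hM he ξ

end Modulation

lemma annularHat_neg {Ω : S2 → ℝ} (he : ∀ x, Ω (-x) = Ω x) (ξ : R3) :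
    annularHat Ω (-ξ) = annularHat Ω ξ := by
  rw [annularHat, fourier_ofReal_neg]
  exact Complex.conj_eq_iff_re.2 (annularHat_re he ξ)

/-- By uniqueness Ωt is the explicit angle function, built from the transform of an even function.
-/
lemma IsFourierAngle.even {s : ℝ} {Ω Ωt : S2 → ℝ} (hs0 : 0 < s) (hs3 : s < 3)
    (hΩ : ConditionH Ω) (h : IsFourierAngle s Ω Ωt) (ξ : S2) : Ωt (-ξ) = Ωt ξ := by
  rw [h.unique hs0 hs3 (isFourierAngle_fourierAngle hs0 hs3 hΩ)]
  simp only [fourierAngle]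
  congr 2
  ext t
  rw [← annularHat_neg hΩ.even]
  simp

section Modulation

variable {s : ℝ} {Ω Ωt : S2 → ℝ} {g : R3 → ℝ}

/-- Multiplication by a character translates the transform. The character is split into cosine and
sine since the energy inequality is available only for real functions. -/
lemma fourier_modulation (hg : Continuous g) (hs : HasCompactSupport g) (v ξ : R3) :
    𝓕 (fun x => ((g x * Real.cos (2 * Real.pi * inner ℝ x v) : ℝ) : ℂ)) ξ +
      Complex.I * 𝓕 (fun x => ((g x * Real.sin (2 * Real.pi * inner ℝ x v) : ℝ) : ℂ)) ξ =
      𝓕 (fun x => (g x : ℂ)) (ξ - v) := by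
  have hi : ∀ k : ℝ → ℝ, Continuous k → Integrable fun x : R3 =>
      Real.fourierChar (-inner ℝ x ξ) • ((g x * k (2 * Real.pi * inner ℝ x v) : ℝ) : ℂ) := by
    intro k hk
    refine Continuous.integrable_of_hasCompactSupport ?_ ?_
    · have : Continuous fun x : R3 => ((g x * k (2 * Real.pi * inner ℝ x v) : ℝ) : ℂ) := by
        fun_prop
      exact (Real.continuous_fourierChar.comp (by fun_prop)).smul this
    · refine hs.mono fun x hx => ?_
      rw [Function.mem_support] at hx ⊢
      intro h0
      simp [h0] at hx
  rw [Real.fourier_eq, Real.fourier_eq, Real.fourier_eq, ← integral_const_mul,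
    ← integral_add (hi _ Real.continuous_cos) ((hi _ Real.continuous_sin).const_mul _)]
  congr 1
  ext x
  have h1 : -inner ℝ x (ξ - v) = -inner ℝ x ξ + inner ℝ x v := by
    rw [inner_sub_right]; ring
  rw [h1, AddChar.map_add_eq_mul]
  have h2 : ((Real.fourierChar (inner ℝ x v : ℝ) : Circle) : ℂ) =
      Real.cos (2 * Real.pi * inner ℝ x v) + Real.sin (2 * Real.pi * inner ℝ x v) * Complex.I := by
    rw [Real.fourierChar_apply, Complex.exp_mul_I]
    push_cast
    ring_nf
  simp only [Circle.smul_def, smul_eq_mul, Circle.coe_mul, h2]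
  push_cast
  ring

/-- With A, B the cosine and sine transforms at ξ, the terms on the left are |A + iB|² and, by
conjugate symmetry, |A - iB|². The parallelogram law removes the cross term. -/
lemma norm_sq_fourier_modulation (hg : Continuous g) (hs : HasCompactSupport g) (v ξ : R3) :
    ‖𝓕 (fun x => (g x : ℂ)) (ξ - v)‖ ^ 2 + ‖𝓕 (fun x => (g x : ℂ)) (-ξ - v)‖ ^ 2 =
      2 * (‖𝓕 (fun x => ((g x * Real.cos (2 * Real.pi * inner ℝ x v) : ℝ) : ℂ)) ξ‖ ^ 2 +
        ‖𝓕 (fun x => ((g x * Real.sin (2 * Real.pi * inner ℝ x v) : ℝ) : ℂ)) ξ‖ ^ 2) := by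
  rw [← fourier_modulation hg hs, ← fourier_modulation hg hs, fourier_ofReal_neg,
    fourier_ofReal_neg]
  generalize 𝓕 (fun x => ((g x * Real.cos (2 * Real.pi * inner ℝ x v) : ℝ) : ℂ)) ξ = A
  generalize 𝓕 (fun x => ((g x * Real.sin (2 * Real.pi * inner ℝ x v) : ℝ) : ℂ)) ξ = B
  simp only [← Complex.normSq_eq_norm_sq, Complex.normSq_apply, Complex.add_re, Complex.add_im,
    Complex.mul_re, Complex.mul_im, Complex.I_re, Complex.I_im, Complex.conj_re, Complex.conj_im]
  ring

lemma weight_neg (he : ∀ x, Ωt (-x) = Ωt x) (e ξ : R3) :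
    weight s Ωt e (-ξ) = weight s Ωt e ξ := by
  rw [weight, homExt_neg he, inner_neg_left, weight, Even.neg_pow (by decide)]

/-- Since the weight is even, averaging over ξ and -ξ costs nothing and reduces a translated profile
to the two real modulations. -/
lemma HasLIC.integral_weight_translate_nonneg (hs0 : 0 < s) (hs3 : s < 3) (hΩ : ConditionH Ω)
    (hL : HasLIC (potential s Ω)) (h : IsFourierAngle s Ω Ωt) {e : R3} (he : ‖e‖ = 1)
    (hg : ContDiff ℝ ∞ g) (hs : HasCompactSupport g) (v : R3) :
    0 ≤ ∫ ξ, weight s Ωt e ξ * ‖𝓕 (fun x => (g x : ℂ)) (ξ - v)‖ ^ 2 := by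
  have hc : ContDiff ℝ ∞ fun x => g x * Real.cos (2 * Real.pi * inner ℝ x v) :=
    hg.mul (Real.contDiff_cos.comp (contDiff_const.mul (contDiff_id.inner ℝ contDiff_const)))
  have hsn : ContDiff ℝ ∞ fun x => g x * Real.sin (2 * Real.pi * inner ℝ x v) :=
    hg.mul (Real.contDiff_sin.comp (contDiff_const.mul (contDiff_id.inner ℝ contDiff_const)))
  have hcs : HasCompactSupport fun x => g x * Real.cos (2 * Real.pi * inner ℝ x v) := hs.mul_right
  have hss : HasCompactSupport fun x => g x * Real.sin (2 * Real.pi * inner ℝ x v) := hs.mul_right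
  obtain ⟨A, hA⟩ := exists_schwartz_ofReal hc hcs
  obtain ⟨B, hB⟩ := exists_schwartz_ofReal hsn hss
  have hA' : ⇑(𝓕 A : 𝓢(R3, ℂ)) = 𝓕 (fun x => ((g x * Real.cos (2 * Real.pi * inner ℝ x v) : ℝ) : ℂ)) := by
    rw [SchwartzMap.fourier_coe, ← funext hA]
  have hB' : ⇑(𝓕 B : 𝓢(R3, ℂ)) = 𝓕 (fun x => ((g x * Real.sin (2 * Real.pi * inner ℝ x v) : ℝ) : ℂ)) := by
    rw [SchwartzMap.fourier_coe, ← funext hB]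
  have iA := integrable_weight_mul hs0 hs3 h.1 he (𝓕 A)
  have iB := integrable_weight_mul hs0 hs3 h.1 he (𝓕 B)
  have iH := integrable_weight_mul hs0 hs3 h.1 he (𝓕 A + Complex.I • 𝓕 B)
  have hH : ∀ ξ, (𝓕 A + Complex.I • 𝓕 B) ξ = 𝓕 (fun x => (g x : ℂ)) (ξ - v) := by
    intro ξ
    rw [← fourier_modulation hg.continuous hs, ← hA', ← hB']
    rfl
  simp only [hH] at iH
  have nA := hL.integral_weight_mul_nonneg hs3 hΩ h e hc hcs
  have nB := hL.integral_weight_mul_nonneg hs3 hΩ h e hsn hss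
  rw [← hA'] at nA
  rw [← hB'] at nB
  have hev := h.even hs0 hs3 hΩ
  have key : (∫ ξ, weight s Ωt e ξ * ‖𝓕 (fun x => (g x : ℂ)) (ξ - v)‖ ^ 2) +
      ∫ ξ, weight s Ωt e ξ * ‖𝓕 (fun x => (g x : ℂ)) (ξ - v)‖ ^ 2 =
      2 * ((∫ ξ, weight s Ωt e ξ * ‖(𝓕 A) ξ‖ ^ 2) + ∫ ξ, weight s Ωt e ξ * ‖(𝓕 B) ξ‖ ^ 2) := by
    rw [← integral_add iA iB, ← integral_const_mul]
    conv_lhs => enter [2]; rw [← integral_neg_eq_self]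
    rw [← integral_add iH iH.comp_neg]
    congr 1
    ext ξ
    have := norm_sq_fourier_modulation hg.continuous hs v ξ
    rw [← hA', ← hB'] at this
    rw [weight_neg hev, ← mul_add, this]
    ring
  linarith

/-- Rescaling makes the translated profile concentrate at e, where the weight equals Ωt e. -/
theorem HasLIC.fourierAngle_nonneg (hs0 : 0 < s) (hs3 : s < 3) (hΩ : ConditionH Ω)
    (hL : HasLIC (potential s Ω)) (h : IsFourierAngle s Ω Ωt) (e : S2) : 0 ≤ Ωt e := by
  have he : ‖(e : R3)‖ = 1 := norm_eq_of_mem_sphere e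
  have he0 : (e : R3) ≠ 0 := norm_ne_zero_iff.1 (by rw [he]; norm_num)
  let b : ContDiffBump (0 : R3) := ⟨1, 2, by norm_num, by norm_num⟩
  have hb : ContDiff ℝ ∞ b := b.contDiff
  have hbs : HasCompactSupport b := b.hasCompactSupport
  obtain ⟨B, hB⟩ := exists_schwartz_ofReal hb hbs
  have hB' : ⇑(𝓕 B : 𝓢(R3, ℂ)) = 𝓕 (fun x => (b x : ℂ)) := by
    rw [SchwartzMap.fourier_coe, ← funext hB]
  obtain ⟨M, hM0, hM⟩ := exists_bound_of_continuous_sphere h.1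
  -- Translate by e / t; homogeneity of the weight of degree s + 1 turns its value at η + e / t into
  -- its value at t η + e up to a positive factor.
  have hscale : ∀ t : ℝ, 0 < t → 0 ≤ ∫ η, weight s Ωt e (t • η + e) * ‖(𝓕 B) η‖ ^ 2 := by
    intro t ht
    have h1 := hL.integral_weight_translate_nonneg hs0 hs3 hΩ h he hb hbs (t⁻¹ • (e : R3))
    rw [← integral_add_right_eq_self _ (t⁻¹ • (e : R3))] at h1
    simp only [add_sub_cancel_right] at h1
    rw [← hB'] at h1
    have h2 : ∀ η, weight s Ωt e (t • η + e) * ‖(𝓕 B) η‖ ^ 2 =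
        t ^ (s + 1) * (weight s Ωt e (η + t⁻¹ • (e : R3)) * ‖(𝓕 B) η‖ ^ 2) := by
      intro η
      rw [← mul_assoc, ← weight_smul ht, smul_add, smul_smul, mul_inv_cancel₀ ht.ne', one_smul]
    simp only [h2]
    rw [integral_const_mul]
    exact mul_nonneg (by positivity) h1
  have hlim : Filter.Tendsto
      (fun n : ℕ => ∫ η, weight s Ωt e ((1 / ((n : ℝ) + 1)) • η + e) * ‖(𝓕 B) η‖ ^ 2)
      Filter.atTop (nhds (∫ η, Ωt e * ‖(𝓕 B) η‖ ^ 2)) := by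
    refine tendsto_integral_of_dominated_convergence
      -- The constant 16 is 2⁴, from 1 + ‖t η + e‖ ≤ 2 (1 + ‖η‖) for 0 ≤ t ≤ 1.
      (fun η => 16 * M * ((1 + ‖η‖) ^ 4 * ‖(𝓕 B) η‖ ^ 2)) (fun n => ?_)
      ((integrable_one_add_norm_pow_mul_sq (𝓕 B)).const_mul _) (fun n => .of_forall fun η => ?_)
      (.of_forall fun η => ?_)
    · exact (((measurable_weight h.1 e).comp (by fun_prop)).mul
        (by fun_prop)).aestronglyMeasurable
    · rw [norm_mul, Real.norm_eq_abs, norm_pow, norm_norm, ← mul_assoc]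
      gcongr
      refine (abs_weight_le hs0 hs3 hM0.le hM he _).trans ?_
      have h1 : ‖(1 / ((n : ℝ) + 1)) • η + (e : R3)‖ ≤ ‖η‖ + 1 := by
        refine (norm_add_le _ _).trans ?_
        rw [he, norm_smul, Real.norm_of_nonneg (by positivity)]
        gcongr
        exact mul_le_of_le_one_left (norm_nonneg _)
          (div_le_one_of_le₀ (by linarith [n.cast_nonneg (α := ℝ)]) (by positivity))
      calc M * (1 + ‖(1 / ((n : ℝ) + 1)) • η + (e : R3)‖) ^ 4 ≤ M * (2 * (1 + ‖η‖)) ^ 4 := by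
            gcongr
            linarith [norm_nonneg η]
        _ = _ := by ring
    · refine Filter.Tendsto.mul_const _ ?_
      have h1 : Filter.Tendsto (fun n : ℕ => (1 / ((n : ℝ) + 1)) • η + (e : R3)) Filter.atTop
          (nhds (e : R3)) := by
        have := (tendsto_one_div_add_atTop_nhds_zero_nat (𝕜 := ℝ)).smul_const η
        simpa using this.add_const (e : R3)
      have h2 : ContinuousAt (weight s Ωt e) e :=
        (continuousAt_homExt _ h.1 he0).mul (by fun_prop)
      have h3 : weight s Ωt e e = Ωt e := by
        rw [weight, homExt_coe, real_inner_self_eq_norm_sq, he]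
        norm_num
      rw [← h3]
      exact h2.tendsto.comp h1
  have h0 : 0 ≤ ∫ η, Ωt e * ‖(𝓕 B) η‖ ^ 2 :=
    ge_of_tendsto' hlim fun n => hscale _ (by positivity)
  rw [integral_const_mul] at h0
  refine nonneg_of_mul_nonneg_left h0 ?_
  have hi : Integrable fun η => ‖(𝓕 B) η‖ ^ 2 := by
    refine (integrable_one_add_norm_pow_mul_sq (𝓕 B)).mono' (by fun_prop)
      (.of_forall fun η => ?_)
    rw [norm_pow, norm_norm]
    exact le_mul_of_one_le_left (by positivity) (one_le_pow₀ (by linarith [norm_nonneg η]))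
  rw [integral_pos_iff_support_of_nonneg (fun η => by positivity) hi]
  have hcont : Continuous fun η => ‖(𝓕 B) η‖ ^ 2 := by fun_prop
  refine hcont.isOpen_support.measure_pos _ ⟨0, ?_⟩
  have h5 : (𝓕 B) 0 = ((∫ x, b x : ℝ) : ℂ) := by
    rw [hB', Real.fourier_eq, ← integral_complex_ofReal]
    simp
  rw [Function.mem_support, h5, Complex.norm_real]
  have := b.integral_pos (μ := (volume : Measure R3))
  exact pow_ne_zero _ (norm_ne_zero_iff.2 this.ne')

end Modulation

/-! ### Sufficiency: mollification of the kernel. -/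

/-- A normalized smooth bump on `R3`, supported in the ball of radius `1 / 2`. -/
noncomputable def unitBump : R3 → ℝ :=
  (⟨1 / 4, 1 / 2, by norm_num, by norm_num⟩ : ContDiffBump (0 : R3)).normed volume

/-- The mollifier given by the autocorrelation of a bump. Its Fourier transform is nonnegative. -/
noncomputable def mollifier : R3 → ℝ := autocorrelation unitBump

/-- The Fourier transform of the mollifier. -/
noncomputable def mollifierHat (ξ : R3) : ℝ := ‖𝓕 (fun x => (unitBump x : ℂ)) ξ‖ ^ 2

lemma contDiff_unitBump : ContDiff ℝ ∞ unitBump := ContDiffBump.contDiff_normed _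

lemma hasCompactSupport_unitBump : HasCompactSupport unitBump :=
  ContDiffBump.hasCompactSupport_normed _

lemma unitBump_nonneg (x : R3) : 0 ≤ unitBump x := ContDiffBump.nonneg_normed _ _

lemma integral_unitBump : ∫ x, unitBump x = 1 := ContDiffBump.integral_normed _

lemma unitBump_eq_zero {x : R3} (hx : 1 / 2 < ‖x‖) : unitBump x = 0 := by
  unfold unitBump
  by_contra h
  have := Function.mem_support.2 h
  rw [ContDiffBump.support_normed_eq, mem_ball_zero_iff] at this
  simp only at this
  linarith

lemma isBoundedDensity_mollifier : IsBoundedDensity mollifier :=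
  have h := contDiff_unitBump.continuous.isBoundedDensity hasCompactSupport_unitBump
  h.crossCorrelation h

lemma mollifier_nonneg (z : R3) : 0 ≤ mollifier z := autocorrelation_nonneg unitBump_nonneg z

lemma mollifier_eq_zero {z : R3} (hz : 1 < ‖z‖) : mollifier z = 0 :=
  autocorrelation_eq_zero (r := 1 / 2) (fun _ hx => unitBump_eq_zero hx) (by linarith)

lemma exists_schwartz_mollifier : ∃ φ : 𝓢(R3, ℂ), (∀ z, (𝓕 φ) z = (mollifier z : ℂ)) ∧
    ∀ ξ, φ ξ = (mollifierHat ξ : ℂ) :=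
  exists_schwartz_fourier_eq_autocorrelation contDiff_unitBump hasCompactSupport_unitBump

lemma continuous_mollifierHat : Continuous mollifierHat := by
  obtain ⟨φ, -, h⟩ := exists_schwartz_mollifier
  have : mollifierHat = fun ξ => (φ ξ).re := by ext ξ; rw [h]; simp
  rw [this]
  fun_prop

lemma mollifierHat_nonneg (ξ : R3) : 0 ≤ mollifierHat ξ := by unfold mollifierHat; positivity

lemma mollifierHat_zero : mollifierHat 0 = 1 := by
  have h : 𝓕 (fun x => (unitBump x : ℂ)) 0 = 1 := by
    rw [Real.fourier_eq]
    simp only [inner_zero_right, neg_zero, AddChar.map_zero_eq_one, one_smul]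
    rw [integral_complex_ofReal, integral_unitBump, Complex.ofReal_one]
  rw [mollifierHat, h]
  simp

lemma fourierInv_mollifier (ξ : R3) : 𝓕⁻ (fun z => (mollifier z : ℂ)) ξ = mollifierHat ξ := by
  obtain ⟨φ, h1, h2⟩ := exists_schwartz_mollifier
  rw [← h2, ← funext h1, ← SchwartzMap.fourierInv_coe, FourierTransform.fourierInv_fourier_eq]

lemma integral_mollifier : ∫ z, mollifier z = 1 := by
  have h := fourierInv_mollifier 0
  rw [Real.fourierInv_eq, mollifierHat_zero] at h
  simp only [inner_zero_right, AddChar.map_zero_eq_one, one_smul] at h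
  rw [integral_complex_ofReal] at h
  exact_mod_cast h

/-- The homogeneous function `‖x‖ ^ (-s) * Ω (x / ‖x‖)` mollified at scale `ε`. -/
noncomputable def mollified (s : ℝ) (Ω : S2 → ℝ) (ε : ℝ) (x : R3) : ℝ :=
  ∫ z, homExt (-s) Ω (ε • z + x) * mollifier z

section Mollified

variable {s : ℝ} {Ω Ωt : S2 → ℝ}

lemma exists_schwartz_dilated_mollifier {ε : ℝ} (hε : 0 < ε) (x : R3) :
    ∃ φ : 𝓢(R3, ℂ), (∀ y, (𝓕 φ) y = (((ε ^ 3)⁻¹ * mollifier (ε⁻¹ • (y - x)) : ℝ) : ℂ)) ∧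
      ∀ ξ, φ ξ = (mollifierHat (ε • ξ) : ℂ) * Real.fourierChar (inner ℝ x ξ) := by
  obtain ⟨φ, h1, h2⟩ := exists_schwartz_mollifier
  have hc : ContDiff ℝ ∞ fun y : R3 => (((ε ^ 3)⁻¹ * mollifier (ε⁻¹ • (y - x)) : ℝ) : ℂ) := by
    have : (fun y : R3 => (((ε ^ 3)⁻¹ * mollifier (ε⁻¹ • (y - x)) : ℝ) : ℂ)) =
        fun y => (((ε ^ 3)⁻¹ : ℝ) : ℂ) * (𝓕 φ) (ε⁻¹ • (y - x)) := by
      ext y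
      rw [h1]
      push_cast
      rfl
    rw [this]
    exact contDiff_const.mul (((𝓕 φ).smooth _).comp
      ((contDiff_id.sub contDiff_const).const_smul _))
  have hs : HasCompactSupport
      fun y : R3 => (((ε ^ 3)⁻¹ * mollifier (ε⁻¹ • (y - x)) : ℝ) : ℂ) := by
    refine HasCompactSupport.intro (isCompact_closedBall x ε) fun y hy => ?_
    have h3 : 1 < ‖ε⁻¹ • (y - x)‖ := by
      rw [norm_smul, Real.norm_of_nonneg (by positivity), ← dist_eq_norm, inv_mul_eq_div,
        one_lt_div hε]
      simpa using hy
    rw [mollifier_eq_zero h3]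
    simp
  refine ⟨𝓕⁻ (hs.toSchwartzMap hc), fun y => ?_, fun ξ => ?_⟩
  · rw [FourierTransform.fourier_fourierInv_eq]
    rfl
  · rw [← fourierInv_mollifier, SchwartzMap.fourierInv_coe, Real.fourierInv_eq,
      Real.fourierInv_eq, ← integral_add_right_eq_self _ x]
    have h := Measure.integral_comp_inv_smul_of_nonneg (volume : Measure R3)
      (fun z => Real.fourierChar (inner ℝ z (ε • ξ)) • (mollifier z : ℂ)) hε.le
    have h3 : Module.finrank ℝ R3 = 3 := by simp
    rw [h3] at h
    have h4 : ∫ z, Real.fourierChar (inner ℝ z (ε • ξ)) • (mollifier z : ℂ) =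
        (((ε ^ 3)⁻¹ : ℝ) : ℂ) *
          ∫ y, Real.fourierChar (inner ℝ (ε⁻¹ • y) (ε • ξ)) • (mollifier (ε⁻¹ • y) : ℂ) := by
      rw [h, Complex.real_smul, ← mul_assoc, ← Complex.ofReal_mul,
        inv_mul_cancel₀ (by positivity), Complex.ofReal_one, one_mul]
    rw [h4, ← integral_const_mul, ← integral_mul_const]
    congr 1
    ext y
    have h5 : (hs.toSchwartzMap hc) (y + x) =
        (((ε ^ 3)⁻¹ * mollifier (ε⁻¹ • (y + x - x)) : ℝ) : ℂ) := rfl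
    rw [h5, add_sub_cancel_right, inner_add_left, AddChar.map_add_eq_mul, inner_smul_left,
      inner_smul_right]
    simp only [conj_trivial, Circle.smul_def, smul_eq_mul, Circle.coe_mul]
    rw [inv_mul_cancel_left₀ hε.ne']
    push_cast
    ring

/-- Testing the distributional identity on a translated, dilated mollifier yields a pointwise
inversion formula for the mollified kernel. -/
theorem IsFourierAngle.mollified_eq (h : IsFourierAngle s Ω Ωt) {ε : ℝ} (hε : 0 < ε) (x : R3) :
    (mollified s Ω ε x : ℂ) = ∫ ξ, (homExt (-3 + s) Ωt ξ : ℂ) *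
      ((mollifierHat (ε • ξ) : ℂ) * Real.fourierChar (inner ℝ x ξ)) := by
  obtain ⟨φ, h1, h2⟩ := exists_schwartz_dilated_mollifier hε x
  have h3 := h.2 φ
  simp only [h1, h2] at h3
  rw [← h3, mollified, ← integral_complex_ofReal]
  have h4 := Measure.integral_comp_inv_smul_of_nonneg (volume : Measure R3)
    (fun z => ((homExt (-s) Ω (ε • z + x) * mollifier z : ℝ) : ℂ)) hε.le
  have h5 : Module.finrank ℝ R3 = 3 := by simp
  rw [h5] at h4
  have h6 : ∫ z, ((homExt (-s) Ω (ε • z + x) * mollifier z : ℝ) : ℂ) =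
      (((ε ^ 3)⁻¹ : ℝ) : ℂ) * ∫ y : R3,
        ((homExt (-s) Ω (ε • ε⁻¹ • y + x) * mollifier (ε⁻¹ • y) : ℝ) : ℂ) := by
    rw [h4, Complex.real_smul, ← mul_assoc, ← Complex.ofReal_mul,
      inv_mul_cancel₀ (by positivity), Complex.ofReal_one, one_mul]
  rw [h6, ← integral_const_mul, ← integral_add_right_eq_self (fun y : R3 =>
    (homExt (-s) Ω y : ℂ) * (((ε ^ 3)⁻¹ * mollifier (ε⁻¹ • (y - x)) : ℝ) : ℂ)) x]
  congr 1
  ext y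
  rw [smul_smul, mul_inv_cancel₀ hε.ne', one_smul, add_sub_cancel_right]
  push_cast
  ring

lemma mollified_nonneg (hΩ : ∀ x, 0 ≤ Ω x) (ε : ℝ) (x : R3) : 0 ≤ mollified s Ω ε x :=
  integral_nonneg fun z => mul_nonneg (homExt_nonneg hΩ _) (mollifier_nonneg z)

/-- Homogeneity reduces bounds uniform in ε to the single scale ε = 1. -/
lemma mollified_scaling {ε : ℝ} (hε : 0 < ε) (x : R3) :
    mollified s Ω ε x = ε ^ (-s) * mollified s Ω 1 (ε⁻¹ • x) := by
  unfold mollified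
  rw [← integral_const_mul]
  congr 1
  ext z
  rw [← mul_assoc, ← homExt_smul _ _ hε, one_smul, smul_add, smul_smul, mul_inv_cancel₀ hε.ne',
    one_smul]

lemma measurable_mollified (hΩ : Continuous Ω) (ε : ℝ) : Measurable (mollified s Ω ε) := by
  have h : StronglyMeasurable fun p : R3 × R3 => homExt (-s) Ω (ε • p.2 + p.1) * mollifier p.2 :=
    (((measurable_homExt _ hΩ).comp (by fun_prop)).mul
      (isBoundedDensity_mollifier.measurable.comp measurable_snd)).stronglyMeasurable
  exact h.integral_prod_right.measurable

lemma half_norm_le_norm_smul_add {ε : ℝ} (hε : 0 < ε) {x z : R3} (hx : 2 * ε ≤ ‖x‖)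
    (hz : ‖z‖ ≤ 1) : ‖x‖ / 2 ≤ ‖ε • z + x‖ := by
  have h1 : ‖ε • z‖ ≤ ε := by
    rw [norm_smul, Real.norm_of_nonneg hε.le]
    exact mul_le_of_le_one_right hε.le hz
  have h2 := norm_sub_norm_le x (-(ε • z))
  rw [norm_neg, sub_neg_eq_add, add_comm x] at h2
  linarith

lemma abs_homExt_mul_mollifier_le (hs0 : 0 < s) {M : ℝ} (hM0 : 0 ≤ M) (hM : ∀ x, |Ω x| ≤ M)
    {ε : ℝ} (hε : 0 < ε) {x : R3} (hx0 : x ≠ 0) (hx : 2 * ε ≤ ‖x‖) (z : R3) :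
    |homExt (-s) Ω (ε • z + x) * mollifier z| ≤ M * (‖x‖ / 2) ^ (-s) * mollifier z := by
  have hn := norm_pos_iff.2 hx0
  by_cases hz : ‖z‖ ≤ 1
  · rw [abs_mul, abs_of_nonneg (mollifier_nonneg z)]
    refine mul_le_mul_of_nonneg_right ?_ (mollifier_nonneg z)
    refine (abs_homExt_le hM0 hM _).trans ?_
    exact mul_le_mul_of_nonneg_left (Real.rpow_le_rpow_of_nonpos (by positivity)
      (half_norm_le_norm_smul_add hε hx hz) (by linarith)) hM0
  · rw [mollifier_eq_zero (not_le.1 hz)]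
    simp

/-- For ‖w‖ ≥ 2 a shift of length at most 1 keeps at least half the distance to the origin. For ‖w‖
< 2 the average is bounded by local integrability of the kernel, while ‖w‖ ^ (-s) is bounded below.
-/
lemma exists_mollified_one_le (hs0 : 0 < s) (hs3 : s < 3) (hΩ : Continuous Ω) :
    ∃ C, 0 < C ∧ ∀ w : R3, w ≠ 0 → mollified s Ω 1 w ≤ C * ‖w‖ ^ (-s) := by
  obtain ⟨M, hM0, hM⟩ := exists_bound_of_continuous_sphere hΩ
  obtain ⟨K, hK⟩ := isBoundedDensity_mollifier.bounded
  have hK0 : 0 ≤ K := (abs_nonneg _).trans (hK 0)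
  have hI := (integrableOn_homExt_ball (p := -s) (by linarith) hΩ 4).abs
  set I : ℝ := ∫ y in ball (0 : R3) 4, |homExt (-s) Ω y|
  have hI0 : 0 ≤ I := integral_nonneg fun y => abs_nonneg _
  have h2s : (0 : ℝ) < 2 ^ s := by positivity
  refine ⟨M * 2 ^ s + K * I * 2 ^ s, by positivity, fun w hw => ?_⟩
  have hn := norm_pos_iff.2 hw
  by_cases h : 2 * 1 ≤ ‖w‖
  · have h1 : mollified s Ω 1 w ≤ M * (‖w‖ / 2) ^ (-s) := by
      refine (le_abs_self _).trans ?_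
      rw [mollified, ← Real.norm_eq_abs]
      refine (norm_integral_le_of_norm_le
        (isBoundedDensity_mollifier.integrable.const_mul (M * (‖w‖ / 2) ^ (-s)))
        (.of_forall fun z => abs_homExt_mul_mollifier_le hs0 hM0.le hM one_pos hw h z)).trans ?_
      rw [integral_const_mul, integral_mollifier, mul_one]
    refine h1.trans ?_
    rw [Real.div_rpow hn.le (by norm_num), Real.rpow_neg (by norm_num : (0 : ℝ) ≤ 2), div_inv_eq_mul]
    have : 0 ≤ K * I * 2 ^ s * ‖w‖ ^ (-s) := by positivity
    linarith
  · have h1 : mollified s Ω 1 w ≤ K * I := by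
      refine (le_abs_self _).trans ?_
      rw [mollified, ← Real.norm_eq_abs]
      have hg : Integrable fun z : R3 =>
          K * (ball (0 : R3) 4).indicator (fun y => |homExt (-s) Ω y|) (z + w) :=
        (((integrable_indicator_iff measurableSet_ball).2 hI).comp_add_right w).const_mul K
      refine (norm_integral_le_of_norm_le hg (.of_forall fun z => ?_)).trans ?_
      · rw [one_smul, norm_mul, Real.norm_eq_abs, Real.norm_eq_abs]
        by_cases hz : ‖z‖ ≤ 1
        · have : z + w ∈ ball (0 : R3) 4 := by
            rw [mem_ball_zero_iff]
            linarith [norm_add_le z w, not_le.1 h]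
          rw [Set.indicator_of_mem this, mul_comm]
          gcongr
          exact hK z
        · rw [mollifier_eq_zero (not_le.1 hz), abs_zero, mul_zero]
          exact mul_nonneg hK0 (Set.indicator_nonneg (fun _ _ => abs_nonneg _) _)
      · rw [integral_const_mul, integral_add_right_eq_self
          ((ball (0 : R3) 4).indicator fun y => |homExt (-s) Ω y|),
          integral_indicator measurableSet_ball]
    have h3 : 1 ≤ 2 ^ s * ‖w‖ ^ (-s) := by
      rw [Real.rpow_neg hn.le, ← div_eq_mul_inv, ← Real.div_rpow (by norm_num) hn.le]
      refine Real.one_le_rpow ?_ hs0.le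
      rw [one_le_div hn]
      linarith
    have h4 : K * I ≤ K * I * (2 ^ s * ‖w‖ ^ (-s)) := le_mul_of_one_le_right (by positivity) h3
    have h5 : 0 ≤ M * 2 ^ s * ‖w‖ ^ (-s) := by positivity
    linarith

lemma exists_pos_le_of_conditionH (hΩ : ConditionH Ω) : ∃ m, 0 < m ∧ ∀ x, m ≤ Ω x := by
  have hne : Nonempty S2 := ⟨angle (EuclideanSpace.single 0 1) (by simp)⟩
  obtain ⟨x₀, -, hx₀⟩ := isCompact_univ.exists_isMinOn Set.univ_nonempty
    hΩ.smooth.continuous.continuousOn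
  exact ⟨Ω x₀, hΩ.pos x₀, fun x => hx₀ (Set.mem_univ x)⟩

/-- The mollified kernels are dominated by the kernel, uniformly in the scale. -/
theorem exists_mollified_le (hs0 : 0 < s) (hs3 : s < 3) (hΩ : ConditionH Ω) :
    ∃ C, 0 < C ∧ ∀ ε, 0 < ε → ∀ x : R3, x ≠ 0 →
      mollified s Ω ε x ≤ C * homExt (-s) Ω x := by
  obtain ⟨C, hC0, hC⟩ := exists_mollified_one_le hs0 hs3 hΩ.smooth.continuous
  -- The positive minimum of Ω converts a bound by ‖x‖ ^ (-s) into a bound by the kernel.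
  obtain ⟨m, hm0, hm⟩ := exists_pos_le_of_conditionH hΩ
  refine ⟨C / m, by positivity, fun ε hε x hx => ?_⟩
  have hn := norm_pos_iff.2 hx
  rw [mollified_scaling hε, homExt_of_ne _ _ hx]
  calc ε ^ (-s) * mollified s Ω 1 (ε⁻¹ • x)
      ≤ ε ^ (-s) * (C * ‖ε⁻¹ • x‖ ^ (-s)) := by
        gcongr
        exact hC _ (smul_ne_zero (inv_ne_zero hε.ne') hx)
    _ = C / m * (‖x‖ ^ (-s) * m) := by
        rw [norm_smul, Real.norm_of_nonneg (by positivity), Real.mul_rpow (by positivity) hn.le,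
          Real.inv_rpow hε.le]
        have := Real.rpow_pos_of_pos hε (-s)
        field_simp
    _ ≤ C / m * (‖x‖ ^ (-s) * Ω (angle x hx)) := by
        gcongr
        exact hm _

theorem tendsto_mollified (hs0 : 0 < s) (hΩ : Continuous Ω) {x : R3} (hx : x ≠ 0) :
    Filter.Tendsto (fun n : ℕ => mollified s Ω (1 / ((n : ℝ) + 1)) x) Filter.atTop
      (nhds (homExt (-s) Ω x)) := by
  obtain ⟨M, hM0, hM⟩ := exists_bound_of_continuous_sphere hΩ
  have hn := norm_pos_iff.2 hx
  have hlim := tendsto_one_div_add_atTop_nhds_zero_nat (𝕜 := ℝ)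
  have h1 : homExt (-s) Ω x = ∫ z, homExt (-s) Ω x * mollifier z := by
    rw [integral_const_mul, integral_mollifier, mul_one]
  rw [h1]
  refine tendsto_integral_filter_of_dominated_convergence
    (fun z => M * (‖x‖ / 2) ^ (-s) * mollifier z) (.of_forall fun n => ?_) ?_
    (isBoundedDensity_mollifier.integrable.const_mul _) (.of_forall fun z => ?_)
  · exact (((measurable_homExt _ hΩ).comp (by fun_prop)).mul
      isBoundedDensity_mollifier.measurable).aestronglyMeasurable
  · filter_upwards [hlim.eventually_lt_const (show (0 : ℝ) < ‖x‖ / 2 by positivity)] with n hn'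
    exact .of_forall fun z => abs_homExt_mul_mollifier_le hs0 hM0.le hM (by positivity) hx
      (by linarith) z
  · refine Filter.Tendsto.mul_const _ ?_
    have h2 : Filter.Tendsto (fun n : ℕ => (1 / ((n : ℝ) + 1)) • z + x) Filter.atTop
        (nhds x) := by
      simpa using (hlim.smul_const z).add_const x
    exact (continuousAt_homExt _ hΩ hx).tendsto.comp h2

end Mollified

/-! ### Analyticity of characteristic functions of compactly supported measures. -/

section CharFun

/-- Compact support bounds ⟨x, b⟩, hence the exponential for z in bounded sets, so differentiation
under the integral is legitimate. -/
lemma differentiable_integral_cexp {ρ : Measure R3} [IsFiniteMeasure ρ]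
    (h : CompactlySupported ρ) (a b : R3) :
    Differentiable ℂ fun z : ℂ =>
      ∫ x, Complex.exp ((inner ℝ x a + z * inner ℝ x b : ℂ) * Complex.I) ∂ρ := by
  intro z₀
  obtain ⟨K, hK, hρ⟩ := h.ae_mem
  obtain ⟨r, hr⟩ := hK.isBounded.exists_norm_le
  have hd : ∀ (x : R3) (z : ℂ), HasDerivAt
      (fun z : ℂ => Complex.exp ((inner ℝ x a + z * inner ℝ x b : ℂ) * Complex.I))
      (Complex.exp ((inner ℝ x a + z * inner ℝ x b : ℂ) * Complex.I) *
        (inner ℝ x b * Complex.I)) z := by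
    intro x z
    have h1 : HasDerivAt (fun z : ℂ => (inner ℝ x a + z * inner ℝ x b : ℂ) * Complex.I)
        (inner ℝ x b * Complex.I) z := by
      simpa using (((hasDerivAt_id z).mul_const (inner ℝ x b : ℂ)).const_add
        (inner ℝ x a : ℂ)).mul_const Complex.I
    exact h1.cexp
  refine (hasDerivAt_integral_of_dominated_loc_of_deriv_le (μ := ρ) (s := ball z₀ 1)
    (bound := fun _ => Real.exp ((‖z₀‖ + 1) * (r * ‖b‖)) * (r * ‖b‖))
    (ball_mem_nhds z₀ one_pos) (.of_forall fun z => ?_) (h.integrable ?_) ?_ ?_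
    (integrable_const _) (.of_forall fun x z _ => hd x z)).2.differentiableAt
  · exact Continuous.aestronglyMeasurable (by fun_prop)
  · fun_prop
  · exact Continuous.aestronglyMeasurable (by fun_prop)
  · filter_upwards [hρ] with x hx z hz
    have h2 : |inner ℝ x b| ≤ r * ‖b‖ :=
      (abs_real_inner_le_norm x b).trans (by gcongr; exact hr x hx)
    have h3 : |z.im| ≤ ‖z₀‖ + 1 := by
      refine (Complex.abs_im_le_norm z).trans ?_
      have := norm_sub_norm_le z z₀
      rw [mem_ball, dist_eq_norm] at hz
      linarith
    rw [norm_mul, norm_mul, Complex.norm_I, mul_one, Complex.norm_real, Complex.norm_exp,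
      Real.norm_eq_abs]
    gcongr
    have h4 : ((inner ℝ x a + z * inner ℝ x b : ℂ) * Complex.I).re = -(z.im * inner ℝ x b) := by
      simp
    rw [h4]
    refine (neg_le_abs _).trans ?_
    rw [abs_mul]
    gcongr

/-- A compactly supported finite measure is determined by the germ of its characteristic function
at any point. -/
theorem Measure.eq_of_charFun_eventuallyEq {ρ σ : Measure R3} [IsFiniteMeasure ρ]
    [IsFiniteMeasure σ] (hρ : CompactlySupported ρ) (hσ : CompactlySupported σ) {a : R3}
    (h : charFun ρ =ᶠ[nhds a] charFun σ) : ρ = σ := by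
  refine Measure.ext_of_charFun (funext fun ξ => ?_)
  -- F extends the characteristic function on the line through a and ξ to an entire function; z = 0
  -- is a and z = 1 is ξ. Agreement for real z near 0 propagates by the identity theorem.
  let F : Measure R3 → ℂ → ℂ := fun τ z =>
    ∫ x, Complex.exp ((inner ℝ x a + z * inner ℝ x (ξ - a) : ℂ) * Complex.I) ∂τ
  have hF : ∀ (τ : Measure R3) (t : ℝ), F τ t = charFun τ (a + t • (ξ - a)) := by
    intro τ t
    rw [charFun_apply]
    refine integral_congr_ae (.of_forall fun x => ?_)
    simp only
    rw [inner_add_right, inner_smul_right]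
    push_cast
    rfl
  have hd : Differentiable ℂ fun z => F ρ z - F σ z :=
    (differentiable_integral_cexp hρ a (ξ - a)).sub (differentiable_integral_cexp hσ a (ξ - a))
  have hev : ∀ᶠ t : ℝ in nhds 0, F ρ t - F σ t = 0 := by
    have hc : Filter.Tendsto (fun t : ℝ => a + t • (ξ - a)) (nhds 0) (nhds a) := by
      have : Continuous fun t : ℝ => a + t • (ξ - a) := by fun_prop
      simpa using this.tendsto 0
    filter_upwards [hc.eventually h] with t ht
    rw [hF, hF, ht, sub_self]
  have hfr : ∃ᶠ z in nhdsWithin (0 : ℂ) {0}ᶜ, F ρ z - F σ z = 0 := by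
    have ht : Filter.Tendsto (fun t : ℝ => (t : ℂ)) (nhdsWithin 0 {0}ᶜ)
        (nhdsWithin (0 : ℂ) {0}ᶜ) := by
      refine tendsto_nhdsWithin_iff.2 ⟨?_, ?_⟩
      · have := (Complex.continuous_ofReal.tendsto 0).mono_left
          (nhdsWithin_le_nhds (s := ({0}ᶜ : Set ℝ)))
        simpa using this
      · filter_upwards [self_mem_nhdsWithin] with t ht
        simpa using ht
    exact ht.frequently (hev.filter_mono nhdsWithin_le_nhds).frequently
  have h1 := (hd.differentiableOn.analyticOnNhd isOpen_univ).eqOn_zero_of_preconnected_of_frequently_eq_zero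
    isPreconnected_univ (Set.mem_univ 0) hfr (Set.mem_univ 1)
  have h2 : F ρ (1 : ℝ) - F σ (1 : ℝ) = 0 := by simpa using h1
  rw [hF, hF] at h2
  simpa [sub_eq_zero] using h2

end CharFun

/-! ### The mollified energy identity and nonvanishing of the Fourier energy. -/

section PositiveDefinite

variable {s : ℝ} {Ω Ωt : S2 → ℝ}

lemma integral_fourierChar_eq_charFun (ρ : Measure R3) (ξ : R3) :
    ∫ x, (Real.fourierChar (inner ℝ x ξ) : ℂ) ∂ρ = charFun ρ ((2 * Real.pi) • ξ) := by
  rw [charFun_apply]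
  congr 1
  ext x
  rw [Real.fourierChar_apply, inner_smul_right]

lemma integral_fourierChar_neg_eq_charFun (ρ : Measure R3) (ξ : R3) :
    ∫ x, (Real.fourierChar (-inner ℝ x ξ) : ℂ) ∂ρ =
      (starRingEnd ℂ) (charFun ρ ((2 * Real.pi) • ξ)) := by
  rw [← integral_fourierChar_eq_charFun, ← integral_conj]
  congr 1
  ext x
  rw [← Circle.coe_inv_eq_conj, ← AddChar.map_neg_eq_inv]

lemma integrable_homExt_mul_mollifierHat (hs0 : 0 < s) (hs3 : s < 3) (hΩt : Continuous Ωt) {ε : ℝ}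
    (hε : 0 < ε) :
    Integrable fun ξ : R3 => homExt (-3 + s) Ωt ξ * mollifierHat (ε • ξ) := by
  obtain ⟨φ, -, h⟩ := exists_schwartz_dilated_mollifier hε 0
  have h1 := (integrable_homExt_mul (p := -3 + s) (by linarith) (by linarith) hΩt φ).re
  refine h1.congr (.of_forall fun ξ => ?_)
  simp [h]

/-- Insert the inversion formula and exchange integrals: the characters integrate to characteristic
functions. The factor `mollifierHat` makes the multiplier absolutely integrable, which Fubini needs.
-/
lemma IsFourierAngle.integral_mollified_prod (hs0 : 0 < s) (hs3 : s < 3)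
    (h : IsFourierAngle s Ω Ωt) {ε : ℝ} (hε : 0 < ε) (ρ σ : Measure R3) [IsFiniteMeasure ρ]
    [IsFiniteMeasure σ] :
    ((∫ p : R3 × R3, mollified s Ω ε (p.1 - p.2) ∂(ρ.prod σ) : ℝ) : ℂ) =
      ∫ ξ, ((homExt (-3 + s) Ωt ξ * mollifierHat (ε • ξ) : ℝ) : ℂ) *
        (charFun ρ ((2 * Real.pi) • ξ) *
          (starRingEnd ℂ) (charFun σ ((2 * Real.pi) • ξ))) := by
  rw [← integral_complex_ofReal]
  simp only [h.mollified_eq hε]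
  have hsplit : ∀ (p : R3 × R3) (ξ : R3), (homExt (-3 + s) Ωt ξ : ℂ) *
      ((mollifierHat (ε • ξ) : ℂ) * Real.fourierChar (inner ℝ (p.1 - p.2) ξ)) =
      ((homExt (-3 + s) Ωt ξ * mollifierHat (ε • ξ) : ℝ) : ℂ) *
        ((Real.fourierChar (inner ℝ p.1 ξ) : ℂ) * (Real.fourierChar (-inner ℝ p.2 ξ) : ℂ)) := by
    intro p ξ
    rw [inner_sub_left, sub_eq_add_neg, AddChar.map_add_eq_mul]
    push_cast
    ring
  simp only [hsplit]
  rw [integral_integral_swap]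
  · congr 1
    ext ξ
    rw [integral_const_mul, ← integral_fourierChar_neg_eq_charFun,
      ← integral_fourierChar_eq_charFun, ← integral_prod_mul]
  · have h0 : Integrable fun ξ : R3 =>
        ((homExt (-3 + s) Ωt ξ * mollifierHat (ε • ξ) : ℝ) : ℂ) :=
      (integrable_homExt_mul_mollifierHat hs0 hs3 h.1 hε).ofReal
    have hi : Integrable (fun q : (R3 × R3) × R3 =>
        ((homExt (-3 + s) Ωt q.2 * mollifierHat (ε • q.2) : ℝ) : ℂ))
        ((ρ.prod σ).prod volume) :=
      h0.comp_snd (ρ.prod σ)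
    refine hi.mul_bdd (c := 1) (Continuous.aestronglyMeasurable ?_) (.of_forall fun q => ?_)
    · have := Real.continuous_fourierChar
      fun_prop
    · rw [norm_mul, Circle.norm_coe, Circle.norm_coe, one_mul]

lemma integrable_homExt_mul_charFun (hs0 : 0 < s) (hs3 : s < 3) (hΩt : Continuous Ωt) {ε : ℝ}
    (hε : 0 < ε) (ρ σ : Measure R3) [IsProbabilityMeasure ρ] [IsProbabilityMeasure σ] :
    Integrable fun ξ => ((homExt (-3 + s) Ωt ξ * mollifierHat (ε • ξ) : ℝ) : ℂ) *
        (charFun ρ ((2 * Real.pi) • ξ) *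
          (starRingEnd ℂ) (charFun σ ((2 * Real.pi) • ξ))) := by
  refine (integrable_homExt_mul_mollifierHat hs0 hs3 hΩt hε).ofReal.mul_bdd (c := 1)
    (Continuous.aestronglyMeasurable ?_) (.of_forall fun q => ?_)
  · have h1 : Continuous (charFun ρ) := continuous_charFun
    have h2 : Continuous (charFun σ) := continuous_charFun
    exact (h1.comp (by fun_prop)).mul (Complex.continuous_conj.comp (h2.comp (by fun_prop)))
  · rw [norm_mul, RCLike.norm_conj]
    exact mul_le_one₀ (norm_charFun_le_one _) (norm_nonneg _) (norm_charFun_le_one _)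

lemma integral_add_sub_add {a b c d : R3 → ℂ} (ha : Integrable a) (hb : Integrable b)
    (hc : Integrable c) (hd : Integrable d) :
    ∫ x, ((a x + b x) - (c x + d x)) =
      ((∫ x, a x) + ∫ x, b x) - ((∫ x, c x) + ∫ x, d x) := by
  rw [integral_sub (f := fun x => a x + b x) (g := fun x => c x + d x) (ha.add hb) (hc.add hd),
    integral_add ha hb, integral_add hc hd]

/-- The mollified energy of a difference of probability measures in Fourier variables. -/
lemma IsFourierAngle.integral_mollified_sub (hs0 : 0 < s) (hs3 : s < 3)
    (h : IsFourierAngle s Ω Ωt) {ε : ℝ} (hε : 0 < ε) (ρ σ : Measure R3) [IsProbabilityMeasure ρ]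
    [IsProbabilityMeasure σ] :
    (∫ p : R3 × R3, mollified s Ω ε (p.1 - p.2) ∂(ρ.prod ρ)) +
      (∫ p : R3 × R3, mollified s Ω ε (p.1 - p.2) ∂(σ.prod σ)) =
    (∫ p : R3 × R3, mollified s Ω ε (p.1 - p.2) ∂(ρ.prod σ)) +
      (∫ p : R3 × R3, mollified s Ω ε (p.1 - p.2) ∂(σ.prod ρ)) +
      ∫ ξ, homExt (-3 + s) Ωt ξ * mollifierHat (ε • ξ) *
        ‖charFun ρ ((2 * Real.pi) • ξ) - charFun σ ((2 * Real.pi) • ξ)‖ ^ 2 := by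
  have i := fun (ρ σ : Measure R3) (_ : IsProbabilityMeasure ρ) (_ : IsProbabilityMeasure σ) =>
    integrable_homExt_mul_charFun hs0 hs3 h.1 hε ρ σ
  have hD : ((∫ ξ, homExt (-3 + s) Ωt ξ * mollifierHat (ε • ξ) *
      ‖charFun ρ ((2 * Real.pi) • ξ) - charFun σ ((2 * Real.pi) • ξ)‖ ^ 2 : ℝ) : ℂ) =
      ∫ ξ, ((((homExt (-3 + s) Ωt ξ * mollifierHat (ε • ξ) : ℝ) : ℂ) *
        (charFun ρ ((2 * Real.pi) • ξ) * (starRingEnd ℂ) (charFun ρ ((2 * Real.pi) • ξ))) +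
        ((homExt (-3 + s) Ωt ξ * mollifierHat (ε • ξ) : ℝ) : ℂ) *
        (charFun σ ((2 * Real.pi) • ξ) * (starRingEnd ℂ) (charFun σ ((2 * Real.pi) • ξ)))) -
        (((homExt (-3 + s) Ωt ξ * mollifierHat (ε • ξ) : ℝ) : ℂ) *
        (charFun ρ ((2 * Real.pi) • ξ) * (starRingEnd ℂ) (charFun σ ((2 * Real.pi) • ξ))) +
        ((homExt (-3 + s) Ωt ξ * mollifierHat (ε • ξ) : ℝ) : ℂ) *
        (charFun σ ((2 * Real.pi) • ξ) * (starRingEnd ℂ) (charFun ρ ((2 * Real.pi) • ξ))))) := by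
    rw [← integral_complex_ofReal]
    congr 1
    ext ξ
    rw [← Complex.normSq_eq_norm_sq, Complex.ofReal_mul, ← Complex.mul_conj, map_sub]
    ring
  rw [integral_add_sub_add (i ρ ρ inferInstance inferInstance) (i σ σ inferInstance inferInstance)
    (i ρ σ inferInstance inferInstance) (i σ ρ inferInstance inferInstance),
    ← h.integral_mollified_prod hs0 hs3 hε, ← h.integral_mollified_prod hs0 hs3 hε,
    ← h.integral_mollified_prod hs0 hs3 hε, ← h.integral_mollified_prod hs0 hs3 hε] at hD
  rw [← Complex.ofReal_inj]
  simp only [Complex.ofReal_add, hD]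
  ring

lemma IsFourierAngle.integrable_mollified (hΩ : Continuous Ω)
    (h : IsFourierAngle s Ω Ωt) {ε : ℝ} (hε : 0 < ε) (ρ σ : Measure R3) [IsFiniteMeasure ρ]
    [IsFiniteMeasure σ] :
    Integrable (fun p : R3 × R3 => mollified s Ω ε (p.1 - p.2)) (ρ.prod σ) := by
  refine Integrable.of_bound ((measurable_mollified hΩ ε).comp
    (measurable_fst.sub measurable_snd)).aestronglyMeasurable
    (∫ ξ, ‖homExt (-3 + s) Ωt ξ * mollifierHat (ε • ξ)‖) (.of_forall fun p => ?_)
  rw [← Complex.norm_real, h.mollified_eq hε]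
  refine (norm_integral_le_integral_norm _).trans (le_of_eq ?_)
  congr 1
  ext ξ
  rw [← Complex.norm_real, norm_mul, norm_mul, Circle.norm_coe, mul_one, Complex.ofReal_mul,
    norm_mul]

/-- Otherwise the kernel would vanish as a distribution, yet its integral against a nonnegative bump
is positive. -/
lemma exists_fourierAngle_ne_zero (hs3 : s < 3) (hΩ : ConditionH Ω)
    (h : IsFourierAngle s Ω Ωt) : ∃ e, Ωt e ≠ 0 := by
  by_contra! hz
  have hV : ∀ ξ, homExt (-3 + s) Ωt ξ = 0 := fun ξ => by
    by_cases hξ : ξ = 0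
    · rw [hξ, homExt_zero]
    · rw [homExt_of_ne _ _ hξ, hz, mul_zero]
  let b : ContDiffBump (0 : R3) := ⟨1, 2, by norm_num, by norm_num⟩
  obtain ⟨B, hB⟩ := exists_schwartz_ofReal b.contDiff b.hasCompactSupport
  have h1 := h.2 (𝓕⁻ B)
  rw [FourierTransform.fourier_fourierInv_eq] at h1
  simp only [hV, hB, Complex.ofReal_zero, zero_mul, integral_zero, ← Complex.ofReal_mul] at h1
  rw [integral_complex_ofReal, Complex.ofReal_eq_zero] at h1
  have hi : Integrable fun x => homExt (-s) Ω x * b x :=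
    (b.continuous.isBoundedDensity b.hasCompactSupport).integrable_homExt_mul (by linarith)
      hΩ.smooth.continuous
  have h2 := (integral_pos_iff_support_of_nonneg (μ := (volume : Measure R3))
    (fun x => mul_nonneg (homExt_nonneg (fun x => (hΩ.pos x).le) x) b.nonneg) hi).2 (by
      refine lt_of_lt_of_le ((isOpen_ball.inter isOpen_compl_singleton).measure_pos volume
        ⟨EuclideanSpace.single 0 1, ?_⟩) (measure_mono (s := ball (0 : R3) 2 ∩ {0}ᶜ) fun x hx => ?_)
      · simp
      · have hx0 : x ≠ 0 := hx.2
        rw [Function.mem_support, homExt_of_ne _ _ hx0]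
        exact mul_ne_zero (mul_ne_zero (Real.rpow_pos_of_pos (norm_pos_iff.2 hx0) _).ne'
          (hΩ.pos _).ne') (b.pos_of_mem_ball hx.1).ne')
  exact h2.ne' h1

/-- Vanishing would hold pointwise off the origin by continuity. Near a direction where Ωt is
nonzero the characteristic functions would then coincide, and their germ determines the measure. -/
lemma lintegral_fourier_energy_ne_zero (hs3 : s < 3) (hΩ : ConditionH Ω)
    (h : IsFourierAngle s Ω Ωt) (h0 : ∀ ξ, 0 ≤ Ωt ξ) {ρ σ : Measure R3} [IsFiniteMeasure ρ]
    [IsFiniteMeasure σ] (hρ : CompactlySupported ρ) (hσ : CompactlySupported σ) (hne : ρ ≠ σ) :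
    ∫⁻ ξ, ENNReal.ofReal (homExt (-3 + s) Ωt ξ *
        ‖charFun ρ ((2 * Real.pi) • ξ) - charFun σ ((2 * Real.pi) • ξ)‖ ^ 2) ≠ 0 := by
  intro hz
  have hcρ : Continuous (charFun ρ) := continuous_charFun
  have hcσ : Continuous (charFun σ) := continuous_charFun
  have hc : Continuous fun ξ : R3 =>
      ‖charFun ρ ((2 * Real.pi) • ξ) - charFun σ ((2 * Real.pi) • ξ)‖ ^ 2 :=
    (((hcρ.comp (by fun_prop)).sub (hcσ.comp (by fun_prop))).norm).pow 2
  have hm : Measurable fun ξ => ENNReal.ofReal (homExt (-3 + s) Ωt ξ *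
      ‖charFun ρ ((2 * Real.pi) • ξ) - charFun σ ((2 * Real.pi) • ξ)‖ ^ 2) :=
    ((measurable_homExt _ h.1).mul hc.measurable).ennreal_ofReal
  rw [lintegral_eq_zero_iff hm] at hz
  have hz' : (fun ξ => homExt (-3 + s) Ωt ξ *
      ‖charFun ρ ((2 * Real.pi) • ξ) - charFun σ ((2 * Real.pi) • ξ)‖ ^ 2) =ᵐ[volume]
      fun _ => 0 := by
    refine hz.mono fun ξ hξ => le_antisymm (ENNReal.ofReal_eq_zero.1 hξ) ?_
    exact mul_nonneg (homExt_nonneg h0 ξ) (by positivity)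
  have heq := Measure.eqOn_open_of_ae_eq (ae_restrict_of_ae hz')
    (isOpen_compl_singleton (x := (0 : R3)))
    ((continuousOn_homExt _ h.1).mul hc.continuousOn) continuousOn_const
  obtain ⟨e, he⟩ := exists_fourierAngle_ne_zero hs3 hΩ h
  have he0 : (e : R3) ≠ 0 := norm_ne_zero_iff.1 (by rw [norm_eq_of_mem_sphere e]; norm_num)
  have hev : ∀ᶠ ξ in nhds (e : R3),
      charFun ρ ((2 * Real.pi) • ξ) = charFun σ ((2 * Real.pi) • ξ) := by
    have h1 : ∀ᶠ ξ in nhds (e : R3), homExt (-3 + s) Ωt ξ ≠ 0 :=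
      (continuousAt_homExt _ h.1 he0).eventually_ne (by rwa [homExt_coe])
    filter_upwards [h1, isOpen_compl_singleton.mem_nhds he0] with ξ h2 h3
    have h4 := heq h3
    simp only [mul_eq_zero, h2, false_or] at h4
    exact sub_eq_zero.1 (norm_eq_zero.1 (pow_eq_zero_iff two_ne_zero |>.1 h4))
  refine hne (Measure.eq_of_charFun_eventuallyEq hρ hσ (a := (2 * Real.pi) • (e : R3)) ?_)
  have hpi : (2 * Real.pi) ≠ 0 := by positivity
  have ht : Filter.Tendsto (fun ξ : R3 => (2 * Real.pi)⁻¹ • ξ)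
      (nhds ((2 * Real.pi) • (e : R3))) (nhds (e : R3)) := by
    have := (continuous_const_smul ((2 * Real.pi)⁻¹)).tendsto ((2 * Real.pi) • (e : R3))
    rwa [smul_smul, inv_mul_cancel₀ hpi, one_smul] at this
  filter_upwards [ht.eventually hev] with ξ hξ
  rwa [smul_smul, mul_inv_cancel₀ hpi, one_smul] at hξ

end PositiveDefinite

/-! ### Removing the mollification and strict positivity. -/

section StrictPositivity

lemma ENNReal.liminf_add_liminf_le (u v : ℕ → ℝ≥0∞) :
    Filter.liminf u Filter.atTop + Filter.liminf v Filter.atTop ≤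
      Filter.liminf (fun n => u n + v n) Filter.atTop := by
  rw [Filter.liminf_eq_iSup_iInf_of_nat, Filter.liminf_eq_iSup_iInf_of_nat,
    Filter.liminf_eq_iSup_iInf_of_nat, ENNReal.iSup_add_iSup_of_monotone]
  · exact iSup_mono fun n => le_iInf₂ fun i hi => add_le_add (iInf₂_le i hi) (iInf₂_le i hi)
  · exact fun m n hmn => le_iInf₂ fun i hi => iInf₂_le i (hmn.trans hi)
  · exact fun m n hmn => le_iInf₂ fun i hi => iInf₂_le i (hmn.trans hi)

variable {s : ℝ} {Ω Ωt : S2 → ℝ}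

lemma mutualEnergy_eq_lintegral_prod {W : R3 → ℝ≥0∞} (hW : Measurable W) (ρ σ : Measure R3)
    [SFinite σ] : mutualEnergy W ρ σ = ∫⁻ p, W (p.1 - p.2) ∂(ρ.prod σ) := by
  have hm : Measurable fun p : R3 × R3 => W (p.1 - p.2) :=
    hW.comp (measurable_fst.sub measurable_snd)
  rw [lintegral_prod _ hm.aemeasurable]
  rfl

/-- The kernel is +∞ on the diagonal, so finite energy makes the diagonal null. In particular there
are no atoms, which makes the diagonal null for mixed products too. -/
lemma ae_sub_ne_zero_of_mutualEnergy_lt_top (hΩ : Continuous Ω) {ρ : Measure R3}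
    [SFinite ρ] (hE : mutualEnergy (singularPotential s Ω) ρ ρ < ⊤) :
    ∀ᵐ p ∂(ρ.prod ρ), p.1 - p.2 ≠ 0 := by
  have hu := measurable_singularPotential (s := s) hΩ
  rw [mutualEnergy_eq_lintegral_prod hu] at hE
  filter_upwards [ae_lt_top (hu.comp (measurable_fst.sub measurable_snd)) hE.ne] with p hp h0
  simp [singularPotential, h0] at hp

lemma measure_singleton_eq_zero_of_ae_sub_ne_zero {ρ : Measure R3} [SFinite ρ]
    (h : ∀ᵐ p ∂(ρ.prod ρ), p.1 - p.2 ≠ 0) (a : R3) : ρ {a} = 0 := by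
  have h1 : (ρ.prod ρ) ({a} ×ˢ {a}) = 0 := by
    refine measure_mono_null (fun p hp => ?_) (ae_iff.1 h)
    simp only [Set.mem_prod, Set.mem_singleton_iff] at hp
    simp [hp.1, hp.2]
  rw [Measure.prod_prod, mul_self_eq_zero] at h1
  exact h1

lemma ae_prod_sub_ne_zero (ρ : Measure R3) {σ : Measure R3} [SFinite σ]
    (h : ∀ a, σ {a} = 0) : ∀ᵐ p ∂(ρ.prod σ), p.1 - p.2 ≠ 0 := by
  have hm : MeasurableSet {p : R3 × R3 | p.1 - p.2 ≠ 0} :=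
    (measurable_fst.sub measurable_snd) (measurableSet_singleton 0).compl
  refine (Measure.ae_prod_iff_ae_ae hm).2 (.of_forall fun x => ?_)
  rw [ae_iff]
  refine measure_mono_null (fun y hy => ?_) (h x)
  simp only [ne_eq, not_not, Set.mem_ofPred_eq, sub_eq_zero] at hy
  exact hy.symm

/-- The dominating function is a multiple of the kernel, integrable because the self-energy is
finite. -/
lemma tendsto_lintegral_mollified (hs0 : 0 < s) (hs3 : s < 3) (hΩ : ConditionH Ω)
    {ρ : Measure R3} [SFinite ρ] (hE : mutualEnergy (singularPotential s Ω) ρ ρ < ⊤) :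
    Filter.Tendsto (fun n : ℕ => ∫⁻ p : R3 × R3, ENNReal.ofReal
      (mollified s Ω (1 / ((n : ℝ) + 1)) (p.1 - p.2)) ∂(ρ.prod ρ)) Filter.atTop
      (nhds (mutualEnergy (singularPotential s Ω) ρ ρ)) := by
  have hu := measurable_singularPotential (s := s) hΩ.smooth.continuous
  have hae := ae_sub_ne_zero_of_mutualEnergy_lt_top hΩ.smooth.continuous hE
  have hm : Measurable fun p : R3 × R3 => singularPotential s Ω (p.1 - p.2) :=
    hu.comp (measurable_fst.sub measurable_snd)
  rw [mutualEnergy_eq_lintegral_prod hu] at hE ⊢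
  obtain ⟨C, hC, hb⟩ := exists_mollified_le hs0 hs3 hΩ
  refine tendsto_lintegral_of_dominated_convergence
    (fun p => ENNReal.ofReal C * singularPotential s Ω (p.1 - p.2)) (fun n => ?_) (fun n => ?_) ?_ ?_
  · exact ((measurable_mollified hΩ.smooth.continuous _).comp
      (measurable_fst.sub measurable_snd)).ennreal_ofReal
  · filter_upwards [hae] with p hp
    rw [singularPotential_of_ne hp, ← ENNReal.ofReal_mul hC.le]
    exact ENNReal.ofReal_le_ofReal (hb _ (by positivity) _ hp)
  · rw [lintegral_const_mul _ hm]
    exact ENNReal.mul_ne_top ENNReal.ofReal_ne_top hE.ne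
  · filter_upwards [hae] with p hp
    rw [singularPotential_of_ne hp]
    exact ENNReal.tendsto_ofReal (tendsto_mollified hs0 hΩ.smooth.continuous hp)

/-- Finiteness of the mutual energy is not assumed, so only the Fatou inequality is used; it is the
direction required. -/
lemma mutualEnergy_le_liminf (hs0 : 0 < s) (hΩ : Continuous Ω)
    {ρ σ : Measure R3} [SFinite σ] (h : ∀ᵐ p ∂(ρ.prod σ), p.1 - p.2 ≠ 0) :
    mutualEnergy (singularPotential s Ω) ρ σ ≤
      Filter.liminf (fun n : ℕ => ∫⁻ p : R3 × R3, ENNReal.ofReal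
        (mollified s Ω (1 / ((n : ℝ) + 1)) (p.1 - p.2)) ∂(ρ.prod σ)) Filter.atTop := by
  rw [mutualEnergy_eq_lintegral_prod (measurable_singularPotential hΩ)]
  refine le_trans (le_of_eq (lintegral_congr_ae ?_)) (lintegral_liminf_le fun n =>
    ((measurable_mollified hΩ _).comp (measurable_fst.sub measurable_snd)).ennreal_ofReal)
  filter_upwards [h] with p hp
  rw [singularPotential_of_ne hp]
  exact (ENNReal.tendsto_ofReal (tendsto_mollified hs0 hΩ hp)).liminf_eq.symm

lemma lintegral_fourier_energy_le_liminf (hΩt : Continuous Ωt) (ρ σ : Measure R3)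
    [IsFiniteMeasure ρ] [IsFiniteMeasure σ] :
    ∫⁻ ξ, ENNReal.ofReal (homExt (-3 + s) Ωt ξ *
        ‖charFun ρ ((2 * Real.pi) • ξ) - charFun σ ((2 * Real.pi) • ξ)‖ ^ 2) ≤
      Filter.liminf (fun n : ℕ => ∫⁻ ξ, ENNReal.ofReal (homExt (-3 + s) Ωt ξ *
        mollifierHat ((1 / ((n : ℝ) + 1)) • ξ) *
        ‖charFun ρ ((2 * Real.pi) • ξ) - charFun σ ((2 * Real.pi) • ξ)‖ ^ 2)) Filter.atTop := by
  have hcρ : Continuous (charFun ρ) := continuous_charFun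
  have hcσ : Continuous (charFun σ) := continuous_charFun
  have hc : Continuous fun ξ : R3 =>
      ‖charFun ρ ((2 * Real.pi) • ξ) - charFun σ ((2 * Real.pi) • ξ)‖ ^ 2 :=
    (((hcρ.comp (by fun_prop)).sub (hcσ.comp (by fun_prop))).norm).pow 2
  refine le_trans (le_of_eq (lintegral_congr fun ξ => ?_)) (lintegral_liminf_le fun n =>
    (((measurable_homExt _ hΩt).mul (continuous_mollifierHat.comp
      (continuous_const_smul _)).measurable).mul hc.measurable).ennreal_ofReal)
  have ht : Filter.Tendsto (fun n : ℕ => mollifierHat ((1 / ((n : ℝ) + 1)) • ξ)) Filter.atTop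
      (nhds 1) := by
    have h1 : Filter.Tendsto (fun n : ℕ => (1 / ((n : ℝ) + 1)) • ξ) Filter.atTop
        (nhds ((0 : ℝ) • ξ)) := tendsto_one_div_add_atTop_nhds_zero_nat.smul_const ξ
    rw [zero_smul] at h1
    have h2 := (continuous_mollifierHat.tendsto 0).comp h1
    rwa [mollifierHat_zero] at h2
  refine (ENNReal.tendsto_ofReal ?_).liminf_eq.symm
  have := (ht.const_mul (homExt (-3 + s) Ωt ξ)).mul_const
    (‖charFun ρ ((2 * Real.pi) • ξ) - charFun σ ((2 * Real.pi) • ξ)‖ ^ 2)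
  rwa [mul_one] at this

/-- The identity is arranged without subtraction to live in [0, ∞]; nonnegativity of Ωt is what
allows the Fourier term to enter. -/
lemma IsFourierAngle.lintegral_mollified_sub (hs0 : 0 < s) (hs3 : s < 3) (hΩ : ConditionH Ω)
    (h : IsFourierAngle s Ω Ωt) (h0 : ∀ ξ, 0 ≤ Ωt ξ) {ε : ℝ} (hε : 0 < ε) (ρ σ : Measure R3)
    [IsProbabilityMeasure ρ] [IsProbabilityMeasure σ] :
    ∫⁻ p : R3 × R3, ENNReal.ofReal (mollified s Ω ε (p.1 - p.2)) ∂(ρ.prod σ) +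
      ∫⁻ p : R3 × R3, ENNReal.ofReal (mollified s Ω ε (p.1 - p.2)) ∂(σ.prod ρ) +
      ∫⁻ ξ, ENNReal.ofReal (homExt (-3 + s) Ωt ξ * mollifierHat (ε • ξ) *
        ‖charFun ρ ((2 * Real.pi) • ξ) - charFun σ ((2 * Real.pi) • ξ)‖ ^ 2) =
    ∫⁻ p : R3 × R3, ENNReal.ofReal (mollified s Ω ε (p.1 - p.2)) ∂(ρ.prod ρ) +
      ∫⁻ p : R3 × R3, ENNReal.ofReal (mollified s Ω ε (p.1 - p.2)) ∂(σ.prod σ) := by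
  have hnn : ∀ p : R3 × R3, 0 ≤ mollified s Ω ε (p.1 - p.2) := fun p =>
    mollified_nonneg (fun x => (hΩ.pos x).le) _ _
  have hL : ∀ (ρ σ : Measure R3), IsProbabilityMeasure ρ → IsProbabilityMeasure σ →
      ∫⁻ p : R3 × R3, ENNReal.ofReal (mollified s Ω ε (p.1 - p.2)) ∂(ρ.prod σ) =
      ENNReal.ofReal (∫ p : R3 × R3, mollified s Ω ε (p.1 - p.2) ∂(ρ.prod σ)) :=
    fun ρ σ _ _ => (ofReal_integral_eq_lintegral_ofReal
      (h.integrable_mollified hΩ.smooth.continuous hε ρ σ) (.of_forall hnn)).symm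
  have hI : ∀ (ρ σ : Measure R3),
      0 ≤ ∫ p : R3 × R3, mollified s Ω ε (p.1 - p.2) ∂(ρ.prod σ) :=
    fun ρ σ => integral_nonneg hnn
  have hcρ : Continuous (charFun ρ) := continuous_charFun
  have hcσ : Continuous (charFun σ) := continuous_charFun
  have hDn : ∀ ξ : R3, 0 ≤ homExt (-3 + s) Ωt ξ * mollifierHat (ε • ξ) *
      ‖charFun ρ ((2 * Real.pi) • ξ) - charFun σ ((2 * Real.pi) • ξ)‖ ^ 2 := fun ξ =>
    mul_nonneg (mul_nonneg (homExt_nonneg h0 ξ) (mollifierHat_nonneg _)) (by positivity)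
  have hDi : Integrable fun ξ : R3 => homExt (-3 + s) Ωt ξ * mollifierHat (ε • ξ) *
      ‖charFun ρ ((2 * Real.pi) • ξ) - charFun σ ((2 * Real.pi) • ξ)‖ ^ 2 := by
    refine (integrable_homExt_mul_mollifierHat hs0 hs3 h.1 hε).mul_bdd (c := 2 ^ 2)
      (Continuous.aestronglyMeasurable
        ((((hcρ.comp (by fun_prop)).sub (hcσ.comp (by fun_prop))).norm).pow 2))
      (.of_forall fun ξ => ?_)
    rw [norm_pow, norm_norm]
    refine pow_le_pow_left₀ (norm_nonneg _) ((norm_sub_le _ _).trans ?_) 2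
    linarith [norm_charFun_le_one (μ := ρ) ((2 * Real.pi) • ξ),
      norm_charFun_le_one (μ := σ) ((2 * Real.pi) • ξ)]
  rw [hL ρ σ inferInstance inferInstance, hL σ ρ inferInstance inferInstance,
    hL ρ ρ inferInstance inferInstance, hL σ σ inferInstance inferInstance,
    ← ofReal_integral_eq_lintegral_ofReal hDi (.of_forall hDn),
    ← ENNReal.ofReal_add (hI _ _) (hI _ _), ← ENNReal.ofReal_add (hI _ _) (hI _ _),
    ← ENNReal.ofReal_add (add_nonneg (hI _ _) (hI _ _)) (integral_nonneg hDn),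
    h.integral_mollified_sub hs0 hs3 hε]

/-- Strict positivity of the singular energy on differences of probability measures. -/
theorem IsFourierAngle.two_mul_mutualEnergy_lt (hs0 : 0 < s) (hs3 : s < 3) (hΩ : ConditionH Ω)
    (h : IsFourierAngle s Ω Ωt) (h0 : ∀ ξ, 0 ≤ Ωt ξ) {ρ σ : Measure R3}
    [IsProbabilityMeasure ρ] [IsProbabilityMeasure σ] (hρ : CompactlySupported ρ)
    (hσ : CompactlySupported σ) (hne : ρ ≠ σ)
    (hEρ : mutualEnergy (singularPotential s Ω) ρ ρ < ⊤)
    (hEσ : mutualEnergy (singularPotential s Ω) σ σ < ⊤) :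
    2 * mutualEnergy (singularPotential s Ω) ρ σ <
      mutualEnergy (singularPotential s Ω) ρ ρ + mutualEnergy (singularPotential s Ω) σ σ := by
  have hΩc := hΩ.smooth.continuous
  have hρσ := mutualEnergy_le_liminf (s := s) hs0 hΩc (ae_prod_sub_ne_zero ρ
    (measure_singleton_eq_zero_of_ae_sub_ne_zero
      (ae_sub_ne_zero_of_mutualEnergy_lt_top hΩc hEσ)))
  have hσρ := mutualEnergy_le_liminf (s := s) hs0 hΩc (ae_prod_sub_ne_zero σ
    (measure_singleton_eq_zero_of_ae_sub_ne_zero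
      (ae_sub_ne_zero_of_mutualEnergy_lt_top hΩc hEρ)))
  have hD := lintegral_fourier_energy_le_liminf (s := s) h.1 ρ σ
  have hlim := (tendsto_lintegral_mollified hs0 hs3 hΩ hEρ).add
    (tendsto_lintegral_mollified hs0 hs3 hΩ hEσ)
  -- Superadditivity of the lower limit combines the three Fatou bounds, and the mollified identity
  -- then rewrites their sum as the convergent self-energies.
  have hle := (add_le_add (add_le_add hρσ hσρ) hD).trans ((add_le_add_left
    (ENNReal.liminf_add_liminf_le _ _) _).trans (ENNReal.liminf_add_liminf_le _ _))
  simp only [h.lintegral_mollified_sub hs0 hs3 hΩ h0 (Nat.one_div_pos_of_nat)] at hle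
  rw [hlim.liminf_eq, mutualEnergy_comm (measurable_singularPotential hΩc)
    (singularPotential_neg hΩ.even) (ρ := σ), ← two_mul] at hle
  -- Finiteness of the mutual energy comes out of the inequality; it is needed for adding a nonzero
  -- term to be a strict increase.
  have hfin : 2 * mutualEnergy (singularPotential s Ω) ρ σ ≠ ⊤ :=
    ((le_self_add.trans hle).trans_lt (ENNReal.add_lt_top.2 ⟨hEρ, hEσ⟩)).ne
  exact (ENNReal.lt_add_right hfin
    (lintegral_fourier_energy_ne_zero hs3 hΩ h h0 hρ hσ hne)).trans_le hle

theorem IsFourierAngle.hasLIC (hs0 : 0 < s) (hs3 : s < 3) (hΩ : ConditionH Ω)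
    (h : IsFourierAngle s Ω Ωt) (h0 : ∀ ξ, 0 ≤ Ωt ξ) : HasLIC (potential s Ω) := by
  have hfin : ∀ ρ : Measure R3, IsProbabilityMeasure ρ →
      interactionEnergy (potential s Ω) ρ < ⊤ →
      mutualEnergy (singularPotential s Ω) ρ ρ < ⊤ := fun ρ _ hE => by
    rw [mutualEnergy_self_lt_top_iff, potential_eq_add fun x => (hΩ.pos x).le,
      mutualEnergy_add (measurable_singularPotential hΩ.smooth.continuous)] at hE
    exact le_self_add.trans_lt hE
  intro ρ₀ ρ₁ _ _ h₀ h₁ hne hc hE₀ hE₁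
  have hE₀' := hfin ρ₀ inferInstance hE₀
  have hE₁' := hfin ρ₁ inferInstance hE₁
  exact (strictConvexOn_interactionEnergy_iff hΩ h₀ h₁ hc hE₀' hE₁').2
    (h.two_mul_mutualEnergy_lt hs0 hs3 hΩ h0 h₀ h₁ hne hE₀' hE₁')

end StrictPositivity

theorem theorem2p6 (s : ℝ) (hs0 : 0 < s) (hs3 : s < 3) (Ω : S2 → ℝ) (hΩ : ConditionH Ω) :
    (∃! Ωt : S2 → ℝ, IsFourierAngle s Ω Ωt) ∧
      ∀ Ωt : S2 → ℝ, IsFourierAngle s Ω Ωt →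
        (HasLIC (potential s Ω) ↔ ∀ ξ : S2, 0 ≤ Ωt ξ) := by
  have hf := isFourierAngle_fourierAngle hs0 hs3 hΩ
  exact ⟨⟨fourierAngle s Ω, hf, fun Ωt h => h.unique hs0 hs3 hf⟩, fun Ωt h =>
    ⟨fun hL ξ => hL.fourierAngle_nonneg hs0 hs3 hΩ h ξ, fun h0 => h.hasLIC hs0 hs3 hΩ h0⟩⟩
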